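/- Let $\mathcal E$ be a Euclidean space with inner product $\langle\cdot,\cdot\rangle$, let $\|\cdot\|$ be any norm on $\mathcal E$ with conjugate norm $\|\xi\|_*=\max_{\|z\|\le1}\langle\xi,z\rangle$, and let $Z\subset\mathcal E$ be a nonempty convex compact set. Let $F:Z\to\mathcal E$ be monotone, with $\|F(z)-F(z')\|_*\le L\|z-z'\|+M$ for all $z,z'\in Z$, where $L,M\ge0$, and put $\mathrm{Err}_{\mathrm{vi}}(z)=\sup_{u\in Z}\langle F(u),z-u\rangle$. Let $\omega:Z\to\mathbf R$ be a distance-generating function: $\omega$ is continuous and convex; on the set $Z^o$ of points of $Z$ where the subdifferential $\partial\omega$ of $\omega$ (relative to $Z$) is nonempty there is a continuous selection $\omega'(z)\in\partial\omega(z)$; and for some $\alpha>0$, $\langle\omega'(z)-\omega'(z'),z-z'\rangle\ge\alpha\|z-z'\|^2$ for all $z,z'\in Z^o$. Put $V(z,u)=\omega(u)-\omega(z)-\langle\omega'(z),u-z\rangle$, $z_c=\mathrm{argmin}_Z\,\omega$, $\Theta=\max_{u\in Z}V(z_c,u)$, $\Omega=\sqrt{2\Theta/\alpha}$, and $P(z,\xi)=\mathrm{argmin}_{u\in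 Z}\{\omega(u)+\langle\xi-\omega'(z),u\rangle\}$ for $z\in Z^o$, $\xi\in\mathcal E$. Let $\zeta_0,\zeta_1,\dots$ be i.i.d. random vectors in $\mathbf R^N$ and let $\Xi:Z\times\mathbf R^N\to\mathcal E$ be Borel. The $k$-th call ($k=0,1,\dots$) to the stochastic oracle at a point $z$ returns $\Xi(z,\zeta_k)$. The $t$-step Stochastic Mirror-Prox algorithm ($t\ge1$) with constant stepsize $\gamma>0$ starts at $r_0=z_c$, computes for $\tau=1,\dots,t$ $$w_\tau=P\bigl(r_{\tau-1},\gamma\,\Xi(r_{\tau-1},\zeta_{2\tau-2})\bigr),\qquad r_\tau=P\bigl(r_{\tau-1},\gamma\,\Xi(w_\tau,\zeta_{2\tau-1})\bigr),$$ and outputs $\widehat z_t=\frac1t\sum_{\tau=1}^t w_\tau$. Consider the following assumptions. **Assumption I.** For some $\mu\in[0,\infty)$, all $z\in Z$ and all $i$: $\|\mathbf E\{\Xi(z,\zeta_i)-F(z)\}\|_*\le\mu$ and $\mathbf E\{\|\Xi(z,\zeta_i)-F(z)\|_*^2\}\le M^2$. **Assumption II.** For all $z\in Z$ and all $i$: $\mathbf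 E\{\exp(\|\Xi(z,\zeta_i)-F(z)\|_*^2/M^2)\}\le\exp(1)$. Let the stepsize be $$\gamma=\min\left[\frac{\alpha}{\sqrt3\,L},\ \frac{\alpha\Omega}{M}\sqrt{\frac{2}{21t}}\right],$$ where a term with positive numerator and zero denominator is $+\infty$, and it is supposed that the resulting $\gamma$ is positive and finite. Then under Assumption I $$\mathbf E\{\mathrm{Err}_{\mathrm{vi}}(\widehat z_t)\}\le K_0^*(t):=\frac74\,\frac{\Omega^2L}{t}+7\,\frac{\Omega M}{\sqrt t}+2\mu\Omega .$$ Under Assumptions I and II, in addition, for every $\Lambda>0$, $$\mathrm{Prob}\{\mathrm{Err}_{\mathrm{vi}}(\widehat z_t)>K_0^*(t)+\Lambda K_1^*(t)\}\le\exp(-\Lambda^2/3)+\exp(-\Lambda t),\qquad K_1^*(t)=\frac72\,\frac{\Omega M}{\sqrt t}.$$ Suppose moreover that the variational inequality is a Nash v.i.: $\mathcal E=\mathcal E_1\times\dots\times\mathcal E_m$ (Euclidean direct product), $Z=Z_1\times\dots\times Z_m$ with convex compact $Z_i\subset\mathcal E_i$, and $F(z)=[F^1(z);\dots;F^m(z)]$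 with $F^i(z)\in\partial_{z_i}\phi_i(z_i,z^i)$ for $z\in Z$, where $z^i$ is the collection of the components of $z$ other than $z_i$, each $\phi_i:Z\to\mathbf R$ is Lipschitz continuous, convex in $z_i$ and concave in $z^i$, and $\sum_i\phi_i$ is convex on $Z$. Then both bounds hold with $\mathrm{Err}_{\mathrm{vi}}$ replaced by $$\mathrm{Err}_{\mathrm N}(z)=\sum_{i=1}^m\Bigl[\phi_i(z)-\min_{w_i\in Z_i}\phi_i(w_i,z^i)\Bigr].$$ -/

import Mathlib

noncomputable section

namespace SMP

/-- A minimizer of `f` over `Z` (an arbitrary point if there is none). -/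
def argminOn {E : Type*} [Nonempty E] (f : E → ℝ) (Z : Set E) : E :=
  Classical.epsilon fun v => v ∈ Z ∧ IsMinOn f Z v

theorem argminOn_spec {E : Type*} [Nonempty E] [TopologicalSpace E] {f : E → ℝ} {Z : Set E}
    (hZ : IsCompact Z) (hne : Z.Nonempty) (hf : ContinuousOn f Z) :
    argminOn f Z ∈ Z ∧ IsMinOn f Z (argminOn f Z) :=
  Classical.epsilon_spec (p := fun v => v ∈ Z ∧ IsMinOn f Z v) (hZ.exists_isMinOn hne hf)

section General

variable {E : Type*} [NormedAddCommGroup E] [InnerProductSpace ℝ E]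

/-- A norm on `E`, not necessarily the one coming from the inner product: a seminorm vanishing
only at the origin. -/
def IsNorm (p : Seminorm ℝ E) : Prop := ∀ x, p x = 0 → x = 0

/-- The conjugate norm `‖ξ‖_* = max {⟨ξ, z⟩ : ‖z‖ ≤ 1}`. -/
def dualNorm (p : Seminorm ℝ E) (ξ : E) : ℝ :=
  sSup ((fun z => inner ℝ ξ z) '' {z | p z ≤ 1})

/-- Monotonicity of an operator on `Z`. -/
def IsMonotoneOp (Z : Set E) (F : E → E) : Prop :=
  ∀ z ∈ Z, ∀ z' ∈ Z, 0 ≤ (inner ℝ (F z - F z') (z - z') : ℝ)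

/-- The error `Err_vi(z) = sup_{u ∈ Z} ⟨F(u), z - u⟩`. -/
def errVI (Z : Set E) (F : E → E) (z : E) : ℝ :=
  sSup ((fun u => inner ℝ (F u) (z - u)) '' Z)

/-- The subdifferential at `z` of a function `f` with domain `Z`. -/
def subdiff (Z : Set E) (f : E → ℝ) (z : E) : Set E :=
  {g | ∀ u ∈ Z, f z + inner ℝ g (u - z) ≤ f u}

/-- The set `Z^o` of the points of `Z` at which the subdifferential is nonempty. -/
def interiorDom (Z : Set E) (ω : E → ℝ) : Set E :=
  {z | z ∈ Z ∧ (subdiff Z ω z).Nonempty}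

/-- `ω` is a distance-generating function for `Z`, strongly convex with modulus `α` with respect
to the norm `p`, and `ω'` is the continuous selection of its subdifferential on `Z^o`. -/
structure IsDGF (p : Seminorm ℝ E) (Z : Set E) (ω : E → ℝ) (ω' : E → E) (α : ℝ) : Prop where
  continuousOn : ContinuousOn ω Z
  convexOn : ConvexOn ℝ Z ω
  selection : ∀ z ∈ interiorDom Z ω, ω' z ∈ subdiff Z ω z
  continuousOn_selection : ContinuousOn ω' (interiorDom Z ω)
  modulus_pos : 0 < α
  strong : ∀ z ∈ interiorDom Z ω, ∀ z' ∈ interiorDom Z ω,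
    α * p (z - z') ^ 2 ≤ inner ℝ (ω' z - ω' z') (z - z')

/-- The prox-function `V(z, u)`. -/
def proxFun (ω : E → ℝ) (ω' : E → E) (z u : E) : ℝ :=
  ω u - ω z - inner ℝ (ω' z) (u - z)

/-- The `ω`-center `z_c = argmin_Z ω`. -/
def center (Z : Set E) (ω : E → ℝ) : E := argminOn ω Z

/-- `Θ(z) = max_{u ∈ Z} V(z, u)`. -/
def theta (Z : Set E) (ω : E → ℝ) (ω' : E → E) (z : E) : ℝ :=
  sSup (proxFun ω ω' z '' Z)

/-- `Ω = √(2 Θ(z_c) / α)`. -/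
def radius (Z : Set E) (ω : E → ℝ) (ω' : E → E) (α : ℝ) : ℝ :=
  √(2 * theta Z ω ω' (center Z ω) / α)

/-- The prox-mapping `P(z, ξ) = argmin_{u ∈ Z} {ω(u) + ⟨ξ - ω'(z), u⟩}`. -/
def prox (Z : Set E) (ω : E → ℝ) (ω' : E → E) (z ξ : E) : E :=
  argminOn (fun u => ω u + inner ℝ (ξ - ω' z) u) Z

/-- The point `w_{τ+1}` computed from `r = r_τ`. Here `G k z` is the answer of the oracle at its
`k`-th call (`k = 0, 1, …`), the query being `z`; step `τ + 1` makes the calls `2τ` (at `r_τ`) and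
`2τ + 1` (at `w_{τ+1}`). -/
def searchPoint (Z : Set E) (ω : E → ℝ) (ω' : E → E) (G : ℕ → E → E) (γ : ℕ → ℝ)
    (τ : ℕ) (r : E) : E :=
  prox Z ω ω' r (γ (τ + 1) • G (2 * τ) r)

/-- The points `r_τ` of the Mirror-Prox algorithm with starting point `r₀`. -/
def iterate (Z : Set E) (ω : E → ℝ) (ω' : E → E) (G : ℕ → E → E) (γ : ℕ → ℝ) (r₀ : E) : ℕ → E
  | 0 => r₀
  | τ + 1 =>
    prox Z ω ω' (iterate Z ω ω' G γ r₀ τ)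
      (γ (τ + 1) • G (2 * τ + 1)
        (searchPoint Z ω ω' G γ τ (iterate Z ω ω' G γ r₀ τ)))

/-- The output `ẑ_t = (∑ γ_τ)⁻¹ ∑ γ_τ w_τ`, the sums being over `1 ≤ τ ≤ t`. -/
def output (Z : Set E) (ω : E → ℝ) (ω' : E → E) (G : ℕ → E → E) (γ : ℕ → ℝ) (r₀ : E)
    (t : ℕ) : E :=
  (∑ τ ∈ Finset.range t, γ (τ + 1))⁻¹ •
    ∑ τ ∈ Finset.range t,
      γ (τ + 1) • searchPoint Z ω ω' G γ τ (iterate Z ω ω' G γ r₀ τ)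

/-- The output of the `t`-step Stochastic Mirror-Prox algorithm started at `z_c` and run with the
constant stepsize `γ`, as a random vector: the `k`-th call returns `Ξ(z, ζ_k)`. -/
def smpOutput {S Ω₀ : Type*} (Z : Set E) (ω : E → ℝ) (ω' : E → E) (Ξ : E → S → E)
    (ζ : ℕ → Ω₀ → S) (γ : ℝ) (t : ℕ) (x : Ω₀) : E :=
  output Z ω ω' (fun k z => Ξ z (ζ k x)) (fun _ => γ) (center Z ω) t

/-- Assumption I: bias at most `μ` and variance at most `M²`, uniformly on `Z`. -/
def AssumptionI {S Ω₀ : Type*} [MeasurableSpace Ω₀] (Pr : MeasureTheory.Measure Ω₀)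
    (p : Seminorm ℝ E) (Z : Set E) (F : E → E) (Ξ : E → S → E) (ζ : ℕ → Ω₀ → S)
    (μ M : ℝ) : Prop :=
  ∀ z ∈ Z, ∀ i,
    dualNorm p (∫ x, (Ξ z (ζ i x) - F z) ∂Pr) ≤ μ ∧
    MeasureTheory.Integrable (fun x => dualNorm p (Ξ z (ζ i x) - F z) ^ 2) Pr ∧
    ∫ x, dualNorm p (Ξ z (ζ i x) - F z) ^ 2 ∂Pr ≤ M ^ 2

/-- Assumption II: light tails of the noise, uniformly on `Z`. -/
def AssumptionII {S Ω₀ : Type*} [MeasurableSpace Ω₀] (Pr : MeasureTheory.Measure Ω₀)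
    (p : Seminorm ℝ E) (Z : Set E) (F : E → E) (Ξ : E → S → E) (ζ : ℕ → Ω₀ → S)
    (M : ℝ) : Prop :=
  ∀ z ∈ Z, ∀ i,
    MeasureTheory.Integrable
      (fun x => Real.exp (dualNorm p (Ξ z (ζ i x) - F z) ^ 2 / M ^ 2)) Pr ∧
    ∫ x, Real.exp (dualNorm p (Ξ z (ζ i x) - F z) ^ 2 / M ^ 2) ∂Pr ≤ Real.exp 1

end General

/-- The stepsize `min [α / (√3 L), (α Ω / M) √(2 / (21 t))]`, computed in `[0, ∞]`, so that a
term with a positive numerator and denominator zero is infinite. -/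
def optimalStep (α L M Ω : ℝ) (t : ℕ) : ENNReal :=
  min (ENNReal.ofReal α / ENNReal.ofReal (√3 * L))
    (ENNReal.ofReal (α * Ω) / ENNReal.ofReal M * ENNReal.ofReal (√(2 / (21 * (t : ℝ)))))

/-- The bound `K₀*(t)`. -/
def K₀ (L M μ Ω : ℝ) (t : ℕ) : ℝ :=
  7 / 4 * (Ω ^ 2 * L / t) + 7 * (Ω * M / √t) + 2 * μ * Ω

/-- The deviation scale `K₁*(t)`. -/
def K₁ (M Ω : ℝ) (t : ℕ) : ℝ :=
  7 / 2 * (Ω * M / √t)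

section Nash

variable {m : ℕ} {V : Fin m → Type*} [∀ i, NormedAddCommGroup (V i)]
  [∀ i, InnerProductSpace ℝ (V i)]

/-- A convex Nash equilibrium problem with strategy sets `Zs i` and losses `φ i`. (Lipschitz
continuity does not depend on which norm is used on the product.) -/
structure IsConvexNash (Zs : ∀ i, Set (V i)) (φ : Fin m → (∀ j, V j) → ℝ) : Prop where
  isCompact : ∀ i, IsCompact (Zs i)
  convex : ∀ i, Convex ℝ (Zs i)
  lipschitz : ∀ i, ∃ K, LipschitzOnWith K (φ i) (Set.univ.pi Zs)
  convex_own : ∀ i, ∀ z ∈ Set.univ.pi Zs,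
    ConvexOn ℝ (Zs i) (fun v => φ i (Function.update z i v))
  concave_others : ∀ i, ∀ c ∈ Zs i,
    ConcaveOn ℝ {z | z ∈ Set.univ.pi Zs ∧ z i = c} (φ i)
  convex_sum : ConvexOn ℝ (Set.univ.pi Zs) (fun z => ∑ i, φ i z)

/-- The functional error `Err_N(z) = ∑ᵢ [φᵢ(z) - min_{wᵢ ∈ Zᵢ} φᵢ(wᵢ, zⁱ)]`. -/
def errN (Zs : ∀ i, Set (V i)) (φ : Fin m → (∀ j, V j) → ℝ) (z : ∀ j, V j) : ℝ :=
  ∑ i, (φ i z - sInf ((fun v => φ i (Function.update z i v)) '' Zs i))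

/-- The v.i. given by `Z` and `F` is the Nash v.i. of the convex Nash equilibrium problem
`(Zs, φ)`, where `e` identifies `E` with the Euclidean direct product of the spaces `V i`. -/
structure IsNashVI {E : Type*} [NormedAddCommGroup E] [InnerProductSpace ℝ E]
    (e : E ≃ₗᵢ[ℝ] PiLp 2 V) (Z : Set E) (F : E → E)
    (Zs : ∀ i, Set (V i)) (φ : Fin m → (∀ j, V j) → ℝ) : Prop where
  isConvexNash : IsConvexNash Zs φ
  mem_iff : ∀ z, z ∈ Z ↔ ∀ i, e z i ∈ Zs i
  mem_subdiff : ∀ z ∈ Z, ∀ i,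
    e (F z) i ∈ subdiff (Zs i) (fun v => φ i (Function.update (fun j => e z j) i v)) (e z i)

end Nash

end SMP

end

noncomputable section

namespace SMP

open Filter Topology MeasureTheory ProbabilityTheory

/-! ### The conjugate norm and its comparison with the Euclidean norm -/

section Norms

variable {E : Type*} [NormedAddCommGroup E] [InnerProductSpace ℝ E]

/-! A Mirror-Prox step makes two prox-steps from the same point r: to w with the answer at r, then
to the next r with the answer at w. By `prox_extragradient_le` the second answer, paired with w − u,
is at most a telescoping difference of V plus a squared dual norm of the difference of the two
answers, minus α/2 ‖w − r‖². The Lipschitz part of that difference is absorbed by the negative term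
because √3 L γ ≤ α; there remain M² and the squared errors of the oracle.

Replacing the answer at w by F(w) leaves the error paired with w − u, and u is chosen after the
noise is seen. A second prox-sequence, `ghost`, driven by these errors, replaces u by its own
current point, which depends on the past only; the price is one more telescoping sum and more
squared errors. This gives `mirrorProx_sum_le`, valid for every realization and every u.

Both error measures are dominated by a uniform bound over u on the averaged gap: Err_vi by
monotonicity, Err_N by convexity, concavity and best responses to the average. `IsGapBounded`
isolates this property, so one probabilistic argument serves both.

In that argument each query and each test vector is fixed by earlier noise, and test vectors have
norm at most 2Ω. Summing the bias and variance bounds gives the mean. For the tail, exponential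
moments of the sum of squares and of the linear term give exp(−Λt) and exp(−Λ²/3). As F is not
assumed measurable, the errors along the trajectory and the ghost points need not be random
variables. Hence no conditional expectations are used: `IsSequentialSuper.integral_le` integrates
out one noise term at a time, and only the measurable final quantity is integrated over the whole
space.

On the convex side, ω is controlled only on Z^o. Density of Z^o, with subgradients pointing the
right way, yields the optimality condition for the selection ω' and the quadratic lower bound
`proxFun_ge`. -/

theorem continuous_seminorm [FiniteDimensional ℝ E] (p : Seminorm ℝ E) : Continuous p := by
  have h : ConvexOn ℝ Set.univ p := p.convexOn
  exact h.locallyLipschitz.continuous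

theorem exists_seminorm_le_norm [FiniteDimensional ℝ E] (p : Seminorm ℝ E) :
    ∃ C : ℝ, 0 < C ∧ ∀ x, p x ≤ C * ‖x‖ :=
  Seminorm.bound_of_continuous_normedSpace p (continuous_seminorm p)

theorem IsNorm.exists_norm_le [FiniteDimensional ℝ E] {p : Seminorm ℝ E} (hp : IsNorm p) :
    ∃ c : ℝ, 0 < c ∧ ∀ x, ‖x‖ ≤ c * p x := by
  rcases (Metric.sphere (0 : E) 1).eq_empty_or_nonempty with hS | hS
  · refine ⟨1, one_pos, fun x => ?_⟩
    rcases eq_or_ne x 0 with rfl | hx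
    · simp
    · have : (‖x‖⁻¹ • x) ∈ Metric.sphere (0 : E) 1 := by
        simp [norm_smul, inv_mul_cancel₀ (norm_ne_zero_iff.2 hx)]
      simp [hS] at this
  · obtain ⟨x₀, hx₀, hmin⟩ := (isCompact_sphere (0 : E) 1).exists_isMinOn hS
      (continuous_seminorm p).continuousOn
    have hpos : 0 < p x₀ := by
      refine lt_of_le_of_ne (apply_nonneg p x₀) fun h => ?_
      have := hp x₀ h.symm
      simp [this] at hx₀
    refine ⟨(p x₀)⁻¹, inv_pos.2 hpos, fun x => ?_⟩
    rcases eq_or_ne x 0 with rfl | hx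
    · simp
    · have hx' : 0 < ‖x‖ := norm_pos_iff.2 hx
      have hmem : (‖x‖⁻¹ • x) ∈ Metric.sphere (0 : E) 1 := by
        simp [norm_smul, inv_mul_cancel₀ hx'.ne']
      have h := isMinOn_iff.1 hmin _ hmem
      rw [map_smul_eq_mul, norm_inv, norm_norm, inv_mul_eq_div, le_div_iff₀ hx'] at h
      rw [inv_mul_eq_div, le_div_iff₀ hpos]
      linarith

theorem dualNorm_le {p : Seminorm ℝ E} {ξ : E} {c : ℝ} (h : ∀ z, p z ≤ 1 → (inner ℝ ξ z : ℝ) ≤ c) :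
    dualNorm p ξ ≤ c := by
  refine csSup_le ⟨_, 0, by simp, rfl⟩ ?_
  rintro _ ⟨z, hz, rfl⟩
  exact h z hz

variable [FiniteDimensional ℝ E] {p : Seminorm ℝ E}

theorem bddAbove_dualNorm_set (hp : IsNorm p) (ξ : E) :
    BddAbove ((fun z => (inner ℝ ξ z : ℝ)) '' {z | p z ≤ 1}) := by
  obtain ⟨c, hc, h⟩ := hp.exists_norm_le
  refine ⟨‖ξ‖ * c, ?_⟩
  rintro _ ⟨z, hz, rfl⟩
  have hz : p z ≤ 1 := hz
  refine (real_inner_le_norm ξ z).trans (mul_le_mul_of_nonneg_left ?_ (norm_nonneg _))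
  nlinarith [h z]

theorem inner_le_dualNorm_of_le_one (hp : IsNorm p) (ξ : E) {z : E} (hz : p z ≤ 1) :
    (inner ℝ ξ z : ℝ) ≤ dualNorm p ξ :=
  le_csSup (bddAbove_dualNorm_set hp ξ) ⟨z, hz, rfl⟩

theorem dualNorm_nonneg (hp : IsNorm p) (ξ : E) : 0 ≤ dualNorm p ξ := by
  simpa using inner_le_dualNorm_of_le_one hp ξ (z := 0) (by simp)

theorem inner_le_dualNorm_mul (hp : IsNorm p) (ξ z : E) :
    (inner ℝ ξ z : ℝ) ≤ dualNorm p ξ * p z := by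
  rcases (apply_nonneg p z).eq_or_lt with h | h
  · simp [hp z h.symm]
  · have := inner_le_dualNorm_of_le_one hp ξ (z := (p z)⁻¹ • z) (by
      rw [map_smul_eq_mul, Real.norm_of_nonneg (inv_nonneg.2 h.le), inv_mul_cancel₀ h.ne'])
    rw [real_inner_smul_right, inv_mul_eq_div, div_le_iff₀ h] at this
    exact this

theorem dualNorm_add_le (hp : IsNorm p) (ξ η : E) :
    dualNorm p (ξ + η) ≤ dualNorm p ξ + dualNorm p η :=
  dualNorm_le fun z hz => by
    rw [inner_add_left]
    exact add_le_add (inner_le_dualNorm_of_le_one hp ξ hz) (inner_le_dualNorm_of_le_one hp η hz)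

theorem dualNorm_smul_le (hp : IsNorm p) {c : ℝ} (hc : 0 ≤ c) (ξ : E) :
    dualNorm p (c • ξ) ≤ c * dualNorm p ξ :=
  dualNorm_le fun z hz => by
    rw [real_inner_smul_left]
    exact mul_le_mul_of_nonneg_left (inner_le_dualNorm_of_le_one hp ξ hz) hc

theorem dualNorm_neg_le (hp : IsNorm p) (ξ : E) : dualNorm p (-ξ) ≤ dualNorm p ξ :=
  dualNorm_le fun z hz => by
    have := inner_le_dualNorm_of_le_one hp ξ (z := -z) (by rwa [map_neg_eq_map])
    rwa [inner_neg_right, ← inner_neg_left] at this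

theorem dualNorm_neg (hp : IsNorm p) (ξ : E) : dualNorm p (-ξ) = dualNorm p ξ :=
  le_antisymm (dualNorm_neg_le hp ξ) (by simpa using dualNorm_neg_le hp (-ξ))

theorem dualNorm_sub_le (hp : IsNorm p) (ξ η : E) :
    dualNorm p (ξ - η) ≤ dualNorm p ξ + dualNorm p η := by
  simpa [sub_eq_add_neg, dualNorm_neg hp] using dualNorm_add_le hp ξ (-η)

theorem abs_inner_le_dualNorm_mul (hp : IsNorm p) (ξ z : E) :
    |(inner ℝ ξ z : ℝ)| ≤ dualNorm p ξ * p z := by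
  refine abs_le'.2 ⟨inner_le_dualNorm_mul hp ξ z, ?_⟩
  have := inner_le_dualNorm_mul hp (-ξ) z
  rwa [inner_neg_left, dualNorm_neg hp] at this

theorem exists_dualNorm_le_norm (hp : IsNorm p) :
    ∃ C : ℝ, 0 < C ∧ ∀ ξ, dualNorm p ξ ≤ C * ‖ξ‖ := by
  obtain ⟨c, hc, h⟩ := hp.exists_norm_le
  refine ⟨c, hc, fun ξ => dualNorm_le fun z hz => ?_⟩
  have := real_inner_le_norm ξ z
  have h2 : ‖z‖ ≤ c := by nlinarith [h z]
  nlinarith [norm_nonneg ξ]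

theorem exists_norm_le_dualNorm (hp : IsNorm p) :
    ∃ C : ℝ, 0 < C ∧ ∀ ξ, ‖ξ‖ ≤ C * dualNorm p ξ := by
  obtain ⟨C, hC, h⟩ := exists_seminorm_le_norm p
  refine ⟨C, hC, fun ξ => ?_⟩
  rcases eq_or_ne ξ 0 with rfl | hξ
  · simpa using mul_nonneg hC.le (dualNorm_nonneg hp 0)
  · have hpos := norm_pos_iff.2 hξ
    have h1 := inner_le_dualNorm_mul hp ξ ξ
    rw [real_inner_self_eq_norm_sq] at h1
    have h2 := mul_le_mul_of_nonneg_left (h ξ) (dualNorm_nonneg hp ξ)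
    exact le_of_mul_le_mul_right (by nlinarith) hpos

theorem continuous_dualNorm (hp : IsNorm p) : Continuous (dualNorm p) := by
  obtain ⟨C, hC, h⟩ := exists_dualNorm_le_norm hp
  refine (LipschitzWith.of_le_add_mul (Real.toNNReal C) fun ξ η => ?_).continuous
  have h1 := dualNorm_add_le hp η (ξ - η)
  rw [add_sub_cancel] at h1
  rw [Real.coe_toNNReal _ hC.le, dist_eq_norm]
  linarith [h (ξ - η)]

theorem eq_zero_of_dualNorm_eq_zero (hp : IsNorm p) {ξ : E} (h : dualNorm p ξ = 0) : ξ = 0 := by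
  obtain ⟨C, _, hC⟩ := exists_norm_le_dualNorm hp
  have := hC ξ
  rw [h, mul_zero] at this
  exact norm_le_zero_iff.1 this

end Norms

/-! ### Distance-generating functions and the prox-mapping -/

section Prox

variable {E : Type*} [NormedAddCommGroup E] [InnerProductSpace ℝ E]

theorem nonneg_of_forall_add_mul_nonneg {A B : ℝ}
    (h : ∀ s : ℝ, 0 < s → s ≤ 1 → 0 ≤ A + s * B) : 0 ≤ A := by
  have hlim : Tendsto (fun s : ℝ => A + s * B) (𝓝[>] 0) (𝓝 (A + 0 * B)) :=
    (Continuous.tendsto (by fun_prop) 0).mono_left nhdsWithin_le_nhds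
  rw [zero_mul, add_zero] at hlim
  refine ge_of_tendsto hlim ?_
  filter_upwards [Ioc_mem_nhdsGT (zero_lt_one' ℝ)] with s hs
  exact h s hs.1 hs.2

/-- Points of `Z^o` are dense in `Z`, and an approximating point can be chosen with a subgradient
pointing towards the approximated one. -/
theorem exists_near_subdiff {Z : Set E} (hZc : IsCompact Z) (hZv : Convex ℝ Z)
    {ω : E → ℝ} (hωc : ContinuousOn ω Z) (hωv : ConvexOn ℝ Z ω) {m : E} (hm : m ∈ Z)
    {δ : ℝ} (hδ : 0 < δ) :
    ∃ v ∈ Z, ∃ c : ℝ, 0 ≤ c ∧ c • (m - v) ∈ subdiff Z ω v ∧ ‖v - m‖ ≤ δ := by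
  obtain ⟨b, hb⟩ := (hZc.image_of_continuousOn hωc).bddBelow
  have hb' : ∀ x ∈ Z, b ≤ ω x := fun x hx => hb ⟨x, hx, rfl⟩
  -- With the penalty weight D/δ², comparing the minimizer v with m gives c‖v − m‖² ≤ ω m − ω v ≤ D,
  -- hence ‖v − m‖ ≤ δ. The summand 1 keeps D positive.
  set D : ℝ := ω m - b + 1 with hD
  have hDpos : 0 < D := by have := hb' m hm; linarith
  set c : ℝ := D / δ ^ 2 with hc
  have hcpos : 0 < c := by positivity
  obtain ⟨v, hv, hmin⟩ := hZc.exists_isMinOn ⟨m, hm⟩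
    (f := fun x => ω x + c * ‖x - m‖ ^ 2) (hωc.add (by fun_prop))
  have hmin := isMinOn_iff.1 hmin
  refine ⟨v, hv, 2 * c, by positivity, fun x hx => ?_, ?_⟩
  · have key : 0 ≤ ω x - ω v + 2 * c * inner ℝ (v - m) (x - v) := by
      -- First variation along the segment from v to x: compare, divide by s, let s → 0.
      refine nonneg_of_forall_add_mul_nonneg (B := c * ‖x - v‖ ^ 2) fun s hs hs1 => ?_
      have hmem : (1 - s) • v + s • x ∈ Z := hZv hv hx (by linarith) hs.le (by ring)
      have h1 := hmin _ hmem
      have h2 := hωv.2 hv hx (by linarith : 0 ≤ 1 - s) hs.le (by ring)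
      have h3 : (1 - s) • v + s • x - m = (v - m) + s • (x - v) := by
        rw [sub_smul, smul_sub, one_smul]; abel
      rw [h3, norm_add_sq_real, real_inner_smul_right, norm_smul, mul_pow, Real.norm_eq_abs,
        sq_abs] at h1
      simp only [smul_eq_mul] at h2
      have : 0 ≤ s * (ω x - ω v + 2 * c * inner ℝ (v - m) (x - v) + s * (c * ‖x - v‖ ^ 2)) := by
        nlinarith
      exact nonneg_of_mul_nonneg_right this hs
    have h4 : (inner ℝ ((2 * c) • (m - v)) (x - v) : ℝ) = -(2 * c * inner ℝ (v - m) (x - v)) := by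
      rw [real_inner_smul_left, ← neg_sub v m, inner_neg_left]; ring
    rw [h4]; linarith
  · have h1 := hmin m hm
    simp only [sub_self, norm_zero] at h1
    have h2 := hb' v hv
    have h3 : c * ‖v - m‖ ^ 2 ≤ D := by nlinarith
    rw [hc, div_mul_eq_mul_div, div_le_iff₀ (by positivity)] at h3
    exact le_of_sq_le_sq (le_of_mul_le_mul_left h3 hDpos) hδ.le

variable {p : Seminorm ℝ E} {Z : Set E} {ω : E → ℝ} {ω' : E → E} {α : ℝ}

theorem IsDGF.exists_near (hω : IsDGF p Z ω ω' α) (hZc : IsCompact Z) {m : E} (hm : m ∈ Z)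
    {δ : ℝ} (hδ : 0 < δ) :
    ∃ v ∈ interiorDom Z ω, ∃ c : ℝ, 0 ≤ c ∧ c • (m - v) ∈ subdiff Z ω v ∧ ‖v - m‖ ≤ δ := by
  obtain ⟨v, hv, c, hc, hs, hd⟩ :=
    exists_near_subdiff hZc hω.convexOn.1 hω.continuousOn hω.convexOn hm hδ
  exact ⟨v, ⟨hv, _, hs⟩, c, hc, hs, hd⟩

theorem mem_interiorDom_of_isMinOn {a w : E} (hw : w ∈ Z)
    (hmin : IsMinOn (fun u => ω u + inner ℝ a u) Z w) : w ∈ interiorDom Z ω := by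
  refine ⟨hw, -a, fun u hu => ?_⟩
  have := isMinOn_iff.1 hmin u hu
  rw [inner_neg_left, inner_sub_right]
  linarith

/-- The first-order optimality condition, in terms of the continuous selection. -/
theorem IsDGF.inner_nonneg_of_isMinOn (hω : IsDGF p Z ω ω' α) (hZc : IsCompact Z) {a w : E}
    (hw : w ∈ Z) (hmin : IsMinOn (fun u => ω u + inner ℝ a u) Z w) {u : E} (hu : u ∈ Z) :
    (0 : ℝ) ≤ inner ℝ (ω' w + a) (u - w) := by
  have hwo := mem_interiorDom_of_isMinOn hw hmin
  set s : ℕ → ℝ := fun n => 1 / ((n : ℝ) + 1) with hs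
  have hs0 : ∀ n, 0 < s n := fun n => by positivity
  have hs1 : ∀ n, s n ≤ 1 := fun n => by
    rw [hs]; simp only; rw [div_le_one (by positivity)]; linarith [(Nat.cast_nonneg n : (0:ℝ) ≤ n)]
  have hslim : Tendsto s atTop (𝓝 0) := tendsto_one_div_add_atTop_nhds_zero_nat
  have hmem : ∀ n, w + s n • (u - w) ∈ Z := fun n =>
    hω.convexOn.1.add_smul_sub_mem hw hu ⟨(hs0 n).le, hs1 n⟩
  -- The error s² survives division by s: (v n − w)/s n still tends to u − w.
  choose v hvo _ _ _ hvd using fun n => hω.exists_near hZc (hmem n) (δ := s n ^ 2)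
    (by have := hs0 n; positivity)
  set d : ℕ → E := fun n => (s n)⁻¹ • (v n - w) with hd
  have hdlim : Tendsto d atTop (𝓝 (u - w)) := by
    refine tendsto_iff_norm_sub_tendsto_zero.2
      (squeeze_zero (fun _ => norm_nonneg _) (fun n => ?_) hslim)
    have h1 : d n - (u - w) = (s n)⁻¹ • (v n - (w + s n • (u - w))) := by
      rw [← sub_sub, smul_sub _ (v n - w), inv_smul_smul₀ (hs0 n).ne']
    rw [h1, norm_smul, norm_inv, Real.norm_of_nonneg (hs0 n).le, inv_mul_le_iff₀ (hs0 n), ← sq]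
    exact hvd n
  have hvlim : Tendsto v atTop (𝓝 w) := by
    have h1 : Tendsto (fun n => w + s n • d n) atTop (𝓝 (w + (0 : ℝ) • (u - w))) :=
      tendsto_const_nhds.add (hslim.smul hdlim)
    rw [zero_smul, add_zero] at h1
    refine h1.congr fun n => ?_
    rw [hd]; simp only
    rw [smul_inv_smul₀ (hs0 n).ne', add_sub_cancel]
  have hωlim : Tendsto (fun n => ω' (v n)) atTop (𝓝 (ω' w)) :=
    (hω.continuousOn_selection w hwo).tendsto.comp
      (tendsto_nhdsWithin_iff.2 ⟨hvlim, Eventually.of_forall hvo⟩)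
  -- Minimality of w against v n, added to the subgradient inequality at v n tested at w, gives
  -- ⟨ω'(v n) + a, v n − w⟩ ≥ 0; divide by s n and pass to the limit.
  refine ge_of_tendsto' ((hωlim.add_const a).inner hdlim) fun n => ?_
  have h1 := isMinOn_iff.1 hmin _ (hvo n).1
  have h2 := hω.selection _ (hvo n) w hw
  rw [hd]; simp only
  rw [real_inner_smul_right]
  refine mul_nonneg (inv_nonneg.2 (hs0 n).le) ?_
  rw [inner_add_left, inner_sub_right a]
  rw [← neg_sub (v n) w, inner_neg_right] at h2
  linarith

/-- The continuous selection dominates every subgradient in feasible directions. -/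
theorem IsDGF.inner_le_inner_selection (hω : IsDGF p Z ω ω' α) (hZc : IsCompact Z) {w g : E}
    (hw : w ∈ Z) (hg : g ∈ subdiff Z ω w) {u : E} (hu : u ∈ Z) :
    (inner ℝ g (u - w) : ℝ) ≤ inner ℝ (ω' w) (u - w) := by
  have h := hω.inner_nonneg_of_isMinOn hZc (a := -g) hw (isMinOn_iff.2 fun x hx => by
    have := hg x hx
    rw [inner_sub_right] at this
    simp only [inner_neg_left]
    linarith) hu
  rw [← sub_eq_add_neg, inner_sub_left] at h
  linarith

theorem proxFun_nonneg (hω : IsDGF p Z ω ω' α) {z u : E} (hz : z ∈ interiorDom Z ω)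
    (hu : u ∈ Z) : 0 ≤ proxFun ω ω' z u := by
  have := hω.selection z hz u hu
  unfold proxFun
  linarith

/-- Self-improvement of a quadratic lower bound. For v near the midpoint, V(z,u) = V(v,u) + V(z,v) +
⟨ω'(v) − ω'(z), u − v⟩: the two V's contribute c/4 each, and strong monotonicity contributes α/4. -/
theorem strong_convexity_step [FiniteDimensional ℝ E] (hω : IsDGF p Z ω ω' α) (hZc : IsCompact Z)
    {c : ℝ} (h : ∀ z ∈ interiorDom Z ω, ∀ u ∈ Z, c * p (u - z) ^ 2 ≤ proxFun ω ω' z u) :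
    ∀ z ∈ interiorDom Z ω, ∀ u ∈ Z,
      (c / 2 + α / 4) * p (u - z) ^ 2 ≤ proxFun ω ω' z u := by
  intro z hz u hu
  set m : E := (1 / 2 : ℝ) • z + (1 / 2 : ℝ) • u with hm
  have hmZ : m ∈ Z := hω.convexOn.1 hz.1 hu (by norm_num) (by norm_num) (by norm_num)
  choose v hvo k hk hsub hvd using fun n : ℕ => hω.exists_near hZc hmZ
    (δ := 1 / ((n : ℝ) + 1)) (by positivity)
  have hvlim : Tendsto v atTop (𝓝 m) :=
    tendsto_iff_norm_sub_tendsto_zero.2 (squeeze_zero (fun _ => norm_nonneg _) hvd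
      tendsto_one_div_add_atTop_nhds_zero_nat)
  have hpc := continuous_seminorm p
  have hlim : Tendsto (fun n => c * p (u - v n) ^ 2 + c * p (v n - z) ^ 2 + α * p (v n - z) ^ 2
      - 2 * inner ℝ (ω' z) (m - v n)) atTop
      (𝓝 (c * p (u - m) ^ 2 + c * p (m - z) ^ 2 + α * p (m - z) ^ 2
      - 2 * inner ℝ (ω' z) (m - m))) :=
    (Continuous.tendsto (f := fun x : E => c * p (u - x) ^ 2 + c * p (x - z) ^ 2
      + α * p (x - z) ^ 2 - 2 * inner ℝ (ω' z) (m - x)) (by fun_prop) m).comp hvlim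
  have h1 : u - m = (1 / 2 : ℝ) • (u - z) := by rw [hm]; module
  have h2 : m - z = (1 / 2 : ℝ) • (u - z) := by rw [hm]; module
  rw [h1, h2, sub_self, inner_zero_right, map_smul_eq_mul, Real.norm_of_nonneg (by norm_num)]
    at hlim
  have hval := le_of_tendsto' (b := proxFun ω ω' z u) hlim fun n => ?_
  · nlinarith
  · have e1 := h (v n) (hvo n) u hu
    have e2 := h z hz (v n) (hvo n).1
    have e3 := hω.strong (v n) (hvo n) z hz
    -- The midpoint may lie outside Z^o, where continuity gives no control of ω'(v n). The sign of
    -- ⟨ω'(v n), m − v n⟩ suffices: it dominates the pairing with a subgradient that is a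
    -- nonnegative multiple of m − v n.
    have e4 := hω.inner_le_inner_selection hZc (hvo n).1 (hsub n) hmZ
    have e5 : (0 : ℝ) ≤ inner ℝ (k n • (m - v n)) (m - v n) := by
      rw [real_inner_smul_left]
      exact mul_nonneg (hk n) real_inner_self_nonneg
    have e6 : u - v n = (v n - z) + (2 : ℝ) • (m - v n) := by rw [hm]; module
    have e7 : u - z = (v n - z) + (u - v n) := by abel
    have e8 : proxFun ω ω' z u = proxFun ω ω' (v n) u + proxFun ω ω' z (v n)
        + inner ℝ (ω' (v n) - ω' z) (u - v n) := by
      unfold proxFun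
      rw [e7, inner_add_right, inner_sub_left]
      ring
    rw [e8, e6, inner_add_right, real_inner_smul_right, inner_sub_left _ _ (m - v n)]
    rw [e6] at e1
    linarith

/-- Iterating c ↦ c/2 + α/4 from 0 produces α/2 (1 − 2⁻ⁿ), which tends to the fixed point α/2. -/
theorem proxFun_ge [FiniteDimensional ℝ E] (hω : IsDGF p Z ω ω' α) (hZc : IsCompact Z)
    {z u : E} (hz : z ∈ interiorDom Z ω) (hu : u ∈ Z) :
    α / 2 * p (u - z) ^ 2 ≤ proxFun ω ω' z u := by
  have h : ∀ n : ℕ, ∀ z ∈ interiorDom Z ω, ∀ u ∈ Z,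
      (α / 2 * (1 - (1 / 2) ^ n)) * p (u - z) ^ 2 ≤ proxFun ω ω' z u := by
    intro n
    induction n with
    | zero =>
      intro z hz u hu
      simpa using proxFun_nonneg hω hz hu
    | succ n ih =>
      intro z hz u hu
      refine le_trans (le_of_eq ?_) (strong_convexity_step hω hZc ih z hz u hu)
      rw [pow_succ]
      ring
  have hlim : Tendsto (fun n : ℕ => (α / 2 * (1 - (1 / 2 : ℝ) ^ n)) * p (u - z) ^ 2) atTop
      (𝓝 ((α / 2 * (1 - 0)) * p (u - z) ^ 2)) :=
    ((tendsto_const_nhds.sub (tendsto_pow_atTop_nhds_zero_of_lt_one (by norm_num)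
      (by norm_num))).const_mul _).mul_const _
  rw [sub_zero, mul_one] at hlim
  exact le_of_tendsto' hlim fun n => h n z hz u hu

/-- The minimizer of `ω + ⟨a, ·⟩` over `Z`. -/
def linMin (Z : Set E) (ω : E → ℝ) (a : E) : E :=
  argminOn (fun u => ω u + inner ℝ a u) Z

theorem prox_eq_linMin (z ξ : E) : prox Z ω ω' z ξ = linMin Z ω (ξ - ω' z) := rfl

theorem linMin_spec (hω : IsDGF p Z ω ω' α) (hZc : IsCompact Z) (hZne : Z.Nonempty) (a : E) :
    linMin Z ω a ∈ Z ∧ IsMinOn (fun u => ω u + inner ℝ a u) Z (linMin Z ω a) :=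
  argminOn_spec hZc hZne (hω.continuousOn.add (by fun_prop))

theorem linMin_mem (hω : IsDGF p Z ω ω' α) (hZc : IsCompact Z) (hZne : Z.Nonempty) (a : E) :
    linMin Z ω a ∈ interiorDom Z ω :=
  mem_interiorDom_of_isMinOn (linMin_spec hω hZc hZne a).1 (linMin_spec hω hZc hZne a).2

theorem linMin_inner_nonneg (hω : IsDGF p Z ω ω' α) (hZc : IsCompact Z) (hZne : Z.Nonempty)
    (a : E) {u : E} (hu : u ∈ Z) :
    (0 : ℝ) ≤ inner ℝ (ω' (linMin Z ω a) + a) (u - linMin Z ω a) :=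
  hω.inner_nonneg_of_isMinOn hZc (linMin_spec hω hZc hZne a).1 (linMin_spec hω hZc hZne a).2 hu

/-- Adding the optimality conditions of two minimizers to strong monotonicity bounds their distance
by that of the data. Continuity is needed for measurability of the trajectory. -/
theorem continuous_linMin [FiniteDimensional ℝ E] (hp : IsNorm p) (hω : IsDGF p Z ω ω' α)
    (hZc : IsCompact Z) (hZne : Z.Nonempty) : Continuous (linMin Z ω) := by
  obtain ⟨c, hc, hcp⟩ := hp.exists_norm_le
  have hα := hω.modulus_pos
  refine (LipschitzWith.of_dist_le_mul (K := Real.toNNReal (c ^ 2 / α)) fun a b => ?_).continuous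
  rw [Real.coe_toNNReal _ (by positivity), dist_eq_norm, dist_eq_norm]
  set x := linMin Z ω a
  set y := linMin Z ω b
  have hx := linMin_mem hω hZc hZne a
  have hy := linMin_mem hω hZc hZne b
  have h1 := linMin_inner_nonneg hω hZc hZne a hy.1
  have h2 := linMin_inner_nonneg hω hZc hZne b hx.1
  have h3 := hω.strong x hx y hy
  change (0 : ℝ) ≤ inner ℝ (ω' x + a) (y - x) at h1
  change (0 : ℝ) ≤ inner ℝ (ω' y + b) (x - y) at h2
  rw [← neg_sub x y, inner_neg_right, inner_add_left] at h1
  rw [inner_add_left] at h2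
  rw [inner_sub_left] at h3
  have h4 := abs_real_inner_le_norm (a - b) (x - y)
  rw [inner_sub_left] at h4
  have h5 := (abs_le.1 h4).1
  have h6 := hcp (x - y)
  have h7 : ‖x - y‖ ^ 2 ≤ c ^ 2 * p (x - y) ^ 2 := by
    rw [← mul_pow]; exact pow_le_pow_left₀ (norm_nonneg _) h6 2
  have h8 : α * ‖x - y‖ ^ 2 ≤ c ^ 2 * (‖a - b‖ * ‖x - y‖) := by
    calc α * ‖x - y‖ ^ 2 ≤ c ^ 2 * (α * p (x - y) ^ 2) := by nlinarith
      _ ≤ _ := mul_le_mul_of_nonneg_left (by linarith) (sq_nonneg c)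
  rcases (norm_nonneg (x - y)).eq_or_lt with h | h
  · rw [← h]; positivity
  · rw [div_mul_eq_mul_div, le_div_iff₀ hα]
    exact le_of_mul_le_mul_right (by nlinarith) h

theorem prox_mem (hω : IsDGF p Z ω ω' α) (hZc : IsCompact Z) (hZne : Z.Nonempty) (z ξ : E) :
    prox Z ω ω' z ξ ∈ interiorDom Z ω :=
  linMin_mem hω hZc hZne _

/-- The optimality condition at the prox-point, rewritten by the three-point identity for V. -/
theorem prox_inner_le (hω : IsDGF p Z ω ω' α) (hZc : IsCompact Z) (hZne : Z.Nonempty)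
    (z ξ : E) {u : E} (hu : u ∈ Z) :
    inner ℝ ξ (prox Z ω ω' z ξ - u) ≤ proxFun ω ω' z u - proxFun ω ω' (prox Z ω ω' z ξ) u
      - proxFun ω ω' z (prox Z ω ω' z ξ) := by
  have h := linMin_inner_nonneg hω hZc hZne (ξ - ω' z) hu
  rw [← prox_eq_linMin] at h
  set r := prox Z ω ω' z ξ
  unfold proxFun
  have e1 : u - z = (u - r) + (r - z) := by abel
  rw [e1, inner_add_right, ← neg_sub u r, inner_neg_right]
  rw [inner_add_left, inner_sub_left] at h
  linarith

theorem mul_sub_half_mul_sq_le {α a x : ℝ} (hα : 0 < α) :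
    a * x - α / 2 * x ^ 2 ≤ a ^ 2 / (2 * α) := by
  rw [le_div_iff₀ (by positivity)]
  nlinarith [sq_nonneg (a - α * x)]

theorem prox_step_le [FiniteDimensional ℝ E] (hp : IsNorm p) (hω : IsDGF p Z ω ω' α)
    (hZc : IsCompact Z) (hZne : Z.Nonempty)
    {z : E} (hz : z ∈ interiorDom Z ω) (ξ : E) {u : E} (hu : u ∈ Z) :
    inner ℝ ξ (z - u) ≤ proxFun ω ω' z u - proxFun ω ω' (prox Z ω ω' z ξ) u
      + dualNorm p ξ ^ 2 / (2 * α) := by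
  have h1 := prox_inner_le hω hZc hZne z ξ hu
  set r := prox Z ω ω' z ξ
  have h2 := proxFun_ge hω hZc hz (prox_mem hω hZc hZne z ξ).1
  have h3 := inner_le_dualNorm_mul hp ξ (z - r)
  have h4 := mul_sub_half_mul_sq_le (a := dualNorm p ξ) (x := p (z - r)) hω.modulus_pos
  change α / 2 * p (r - z) ^ 2 ≤ proxFun ω ω' z r at h2
  rw [map_sub_rev] at h2
  have e : z - u = (r - u) + (z - r) := by abel
  rw [e, inner_add_right]
  linarith

/-- Test the optimality of the η-step at u and that of the ξ-step at the η-point; the leftover ⟨η −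
ξ, w − r⟩ is absorbed by V(w, r) through Young's inequality. -/
theorem prox_extragradient_le [FiniteDimensional ℝ E] (hp : IsNorm p) (hω : IsDGF p Z ω ω' α)
    (hZc : IsCompact Z) (hZne : Z.Nonempty)
    {z : E} (hz : z ∈ interiorDom Z ω) (ξ η : E) {u : E} (hu : u ∈ Z) :
    inner ℝ η (prox Z ω ω' z ξ - u) ≤ proxFun ω ω' z u - proxFun ω ω' (prox Z ω ω' z η) u
      + dualNorm p (η - ξ) ^ 2 / (2 * α) - α / 2 * p (prox Z ω ω' z ξ - z) ^ 2 := by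
  have h1 := prox_inner_le hω hZc hZne z η hu
  have h2 := prox_inner_le hω hZc hZne z ξ (prox_mem hω hZc hZne z η).1
  have h3 := proxFun_ge hω hZc (prox_mem hω hZc hZne z ξ) (prox_mem hω hZc hZne z η).1
  have h4 := proxFun_ge hω hZc hz (prox_mem hω hZc hZne z ξ).1
  set r := prox Z ω ω' z η
  set w := prox Z ω ω' z ξ
  have h5 := inner_le_dualNorm_mul hp (η - ξ) (w - r)
  have h6 := mul_sub_half_mul_sq_le (a := dualNorm p (η - ξ)) (x := p (w - r)) hω.modulus_pos
  rw [map_sub_rev] at h3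
  have e : w - u = (r - u) + (w - r) := by abel
  rw [e, inner_add_right]
  rw [inner_sub_left] at h5
  linarith

end Prox

/-! ### The center and the radius Ω -/

section Center

variable {E : Type*} [NormedAddCommGroup E] [InnerProductSpace ℝ E]
  {p : Seminorm ℝ E} {Z : Set E} {ω : E → ℝ} {ω' : E → E} {α : ℝ}

theorem center_mem (hω : IsDGF p Z ω ω' α) (hZc : IsCompact Z) (hZne : Z.Nonempty) :
    center Z ω ∈ interiorDom Z ω := by
  obtain ⟨h1, h2⟩ := argminOn_spec hZc hZne hω.continuousOn
  refine ⟨h1, 0, fun u hu => ?_⟩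
  rw [inner_zero_left, add_zero]
  exact isMinOn_iff.1 h2 u hu

theorem proxFun_le_theta (hω : IsDGF p Z ω ω' α) (hZc : IsCompact Z) (z : E) {u : E}
    (hu : u ∈ Z) : proxFun ω ω' z u ≤ theta Z ω ω' z := by
  refine le_csSup (hZc.image_of_continuousOn ?_).bddAbove ⟨u, hu, rfl⟩
  unfold proxFun
  exact (hω.continuousOn.sub continuousOn_const).sub (by fun_prop)

theorem theta_center_nonneg (hω : IsDGF p Z ω ω' α) (hZc : IsCompact Z) (hZne : Z.Nonempty) :
    0 ≤ theta Z ω ω' (center Z ω) := by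
  have h := center_mem hω hZc hZne
  exact (proxFun_nonneg hω h h.1).trans (proxFun_le_theta hω hZc _ h.1)

theorem mul_radius_sq (hω : IsDGF p Z ω ω' α) (hZc : IsCompact Z) (hZne : Z.Nonempty) :
    α * radius Z ω ω' α ^ 2 = 2 * theta Z ω ω' (center Z ω) := by
  have hα := hω.modulus_pos
  unfold radius
  rw [Real.sq_sqrt (div_nonneg (by linarith [theta_center_nonneg hω hZc hZne]) hα.le)]
  field_simp

theorem sub_center_le_radius [FiniteDimensional ℝ E] (hω : IsDGF p Z ω ω' α) (hZc : IsCompact Z)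
    (hZne : Z.Nonempty) {u : E} (hu : u ∈ Z) :
    p (u - center Z ω) ≤ radius Z ω ω' α := by
  have hα := hω.modulus_pos
  have h1 := proxFun_ge hω hZc (center_mem hω hZc hZne) hu
  have h2 := proxFun_le_theta hω hZc (center Z ω) hu
  refine Real.le_sqrt_of_sq_le ?_
  rw [le_div_iff₀ hα]
  linarith

theorem sub_le_two_mul_radius [FiniteDimensional ℝ E] (hω : IsDGF p Z ω ω' α)
    (hZc : IsCompact Z) (hZne : Z.Nonempty) {u v : E} (hu : u ∈ Z) (hv : v ∈ Z) :
    p (u - v) ≤ 2 * radius Z ω ω' α := by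
  have h1 := sub_center_le_radius hω hZc hZne hu
  have h2 := sub_center_le_radius hω hZc hZne hv
  have h3 := map_sub_le_add p (u - center Z ω) (v - center Z ω)
  rw [sub_sub_sub_cancel_right] at h3
  linarith

end Center

/-! ### Pathwise analysis of Mirror-Prox with the ghost sequence -/

section Trajectory

variable {E : Type*} [NormedAddCommGroup E] [InnerProductSpace ℝ E]

/-- The points `w_{τ+1}` of the Mirror-Prox algorithm. -/
def extraPoint (Z : Set E) (ω : E → ℝ) (ω' : E → E) (G : ℕ → E → E) (γ : ℕ → ℝ) (r₀ : E)
    (τ : ℕ) : E :=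
  searchPoint Z ω ω' G γ τ (iterate Z ω ω' G γ r₀ τ)

/-- The auxiliary prox-sequence driven by the errors of the oracle at the points `w_τ`. -/
def ghost (Z : Set E) (ω : E → ℝ) (ω' : E → E) (F : E → E) (G : ℕ → E → E) (γ : ℕ → ℝ)
    (r₀ : E) : ℕ → E
  | 0 => r₀
  | τ + 1 => prox Z ω ω' (ghost Z ω ω' F G γ r₀ τ)
      (γ (τ + 1) • (F (extraPoint Z ω ω' G γ r₀ τ)
        - G (2 * τ + 1) (extraPoint Z ω ω' G γ r₀ τ)))

/-- The point at which the `k`-th call to the oracle is made. -/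
def query (Z : Set E) (ω : E → ℝ) (ω' : E → E) (G : ℕ → E → E) (γ : ℕ → ℝ) (r₀ : E)
    (k : ℕ) : E :=
  if k % 2 = 0 then iterate Z ω ω' G γ r₀ (k / 2) else extraPoint Z ω ω' G γ r₀ (k / 2)

/-- The vector against which the error of the `k`-th answer of the oracle is tested. -/
def testVector (Z : Set E) (ω : E → ℝ) (ω' : E → E) (F : E → E) (G : ℕ → E → E) (γ : ℕ → ℝ)
    (r₀ : E) (k : ℕ) : E :=
  if k % 2 = 0 then 0
  else extraPoint Z ω ω' G γ r₀ (k / 2) - ghost Z ω ω' F G γ r₀ (k / 2)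

variable {p : Seminorm ℝ E} {Z : Set E} {ω : E → ℝ} {ω' : E → E} {α : ℝ} {F : E → E}
  {G G' : ℕ → E → E} {γ : ℕ → ℝ} {r₀ : E}

theorem iterate_succ (τ : ℕ) :
    iterate Z ω ω' G γ r₀ (τ + 1) = prox Z ω ω' (iterate Z ω ω' G γ r₀ τ)
      (γ (τ + 1) • G (2 * τ + 1) (extraPoint Z ω ω' G γ r₀ τ)) := rfl

theorem extraPoint_eq (τ : ℕ) :
    extraPoint Z ω ω' G γ r₀ τ = prox Z ω ω' (iterate Z ω ω' G γ r₀ τ)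
      (γ (τ + 1) • G (2 * τ) (iterate Z ω ω' G γ r₀ τ)) := rfl

/-- Nonanticipation: this and the following congruences record which answers each point depends on,
and replace adaptedness to a filtration. -/
theorem iterate_congr : ∀ {τ : ℕ}, (∀ j < 2 * τ, G j = G' j) →
    iterate Z ω ω' G γ r₀ τ = iterate Z ω ω' G' γ r₀ τ
  | 0, _ => rfl
  | τ + 1, h => by
    rw [iterate_succ, iterate_succ, extraPoint_eq, extraPoint_eq,
      iterate_congr (τ := τ) fun j hj => h j (by omega), h (2 * τ) (by omega),
      h (2 * τ + 1) (by omega)]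

theorem extraPoint_congr {τ : ℕ} (h : ∀ j < 2 * τ + 1, G j = G' j) :
    extraPoint Z ω ω' G γ r₀ τ = extraPoint Z ω ω' G' γ r₀ τ := by
  rw [extraPoint_eq, extraPoint_eq, iterate_congr (τ := τ) fun j hj => h j (by omega),
    h (2 * τ) (by omega)]

theorem ghost_congr : ∀ {τ : ℕ}, (∀ j < 2 * τ, G j = G' j) →
    ghost Z ω ω' F G γ r₀ τ = ghost Z ω ω' F G' γ r₀ τ
  | 0, _ => rfl
  | τ + 1, h => by
    rw [ghost, ghost, ghost_congr (τ := τ) fun j hj => h j (by omega),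
      extraPoint_congr (τ := τ) fun j hj => h j (by omega), h (2 * τ + 1) (by omega)]

theorem query_congr {k : ℕ} (h : ∀ j < k, G j = G' j) :
    query Z ω ω' G γ r₀ k = query Z ω ω' G' γ r₀ k := by
  unfold query
  split_ifs
  · exact iterate_congr fun j hj => h j (by omega)
  · exact extraPoint_congr fun j hj => h j (by omega)

theorem testVector_congr {k : ℕ} (h : ∀ j < k, G j = G' j) :
    testVector Z ω ω' F G γ r₀ k = testVector Z ω ω' F G' γ r₀ k := by
  unfold testVector
  split_ifs
  · rfl
  · rw [extraPoint_congr fun j hj => h j (by omega), ghost_congr fun j hj => h j (by omega)]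

theorem output_congr {t : ℕ} (h : ∀ j < 2 * t, G j = G' j) :
    output Z ω ω' G γ r₀ t = output Z ω ω' G' γ r₀ t := by
  unfold output
  congr 1
  refine Finset.sum_congr rfl fun τ hτ => ?_
  have hτ := Finset.mem_range.1 hτ
  congr 1
  exact extraPoint_congr (τ := τ) fun j hj => h j (by omega)

theorem output_const {c : ℝ} (hc : c ≠ 0) (t : ℕ) :
    output Z ω ω' G (fun _ => c) r₀ t
      = (t : ℝ)⁻¹ • ∑ τ ∈ Finset.range t, extraPoint Z ω ω' G (fun _ => c) r₀ τ := by
  unfold output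
  rw [Finset.sum_const, Finset.card_range, ← Finset.smul_sum, smul_smul, nsmul_eq_mul, mul_inv,
    mul_assoc, inv_mul_cancel₀ hc, mul_one]
  rfl

theorem iterate_mem (hω : IsDGF p Z ω ω' α) (hZc : IsCompact Z) (hr₀ : r₀ ∈ interiorDom Z ω) :
    ∀ τ, iterate Z ω ω' G γ r₀ τ ∈ interiorDom Z ω
  | 0 => hr₀
  | _ + 1 => prox_mem hω hZc ⟨_, hr₀.1⟩ _ _

theorem extraPoint_mem (hω : IsDGF p Z ω ω' α) (hZc : IsCompact Z) (hZne : Z.Nonempty) (τ : ℕ) :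
    extraPoint Z ω ω' G γ r₀ τ ∈ interiorDom Z ω :=
  prox_mem hω hZc hZne _ _

theorem ghost_mem (hω : IsDGF p Z ω ω' α) (hZc : IsCompact Z) (hr₀ : r₀ ∈ interiorDom Z ω) :
    ∀ τ, ghost Z ω ω' F G γ r₀ τ ∈ interiorDom Z ω
  | 0 => hr₀
  | _ + 1 => prox_mem hω hZc ⟨_, hr₀.1⟩ _ _

theorem query_mem (hω : IsDGF p Z ω ω' α) (hZc : IsCompact Z) (hr₀ : r₀ ∈ interiorDom Z ω)
    (k : ℕ) : query Z ω ω' G γ r₀ k ∈ Z := by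
  unfold query
  split_ifs
  · exact (iterate_mem hω hZc hr₀ _).1
  · exact (extraPoint_mem hω hZc ⟨_, hr₀.1⟩ _).1

theorem sum_range_two_mul (f : ℕ → ℝ) (t : ℕ) :
    ∑ k ∈ Finset.range (2 * t), f k
      = ∑ τ ∈ Finset.range t, (f (2 * τ) + f (2 * τ + 1)) := by
  induction t with
  | zero => simp
  | succ t ih =>
    rw [Nat.mul_succ, Finset.sum_range_succ, Finset.sum_range_succ, Finset.sum_range_succ, ih]
    ring

theorem sq_add_three_le (a b c d : ℝ) :
    (a + b + c + d) ^ 2 ≤ 3 * a ^ 2 + 3 * b ^ 2 + 6 * c ^ 2 + 6 * d ^ 2 := by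
  nlinarith [sq_nonneg (a - b), sq_nonneg (a - (c + d)), sq_nonneg (b - (c + d)),
    sq_nonneg (c - d)]

/-- Write c⟨F w, w − u⟩ as ⟨c h, w − u⟩ − c⟨h − F w, w − y⟩ + ⟨c(F w − h), y − u⟩. The extragradient
inequality handles the first term, the ghost prox-step from y the last; the middle one is the noise
to be averaged. -/
theorem mirrorProx_step_le [FiniteDimensional ℝ E] (hp : IsNorm p) (hω : IsDGF p Z ω ω' α)
    (hZc : IsCompact Z) {L M : ℝ} (hL : 0 ≤ L)
    (hF : ∀ z ∈ Z, ∀ z' ∈ Z, dualNorm p (F z - F z') ≤ L * p (z - z') + M)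
    {c : ℝ} (hc : 0 < c) (hcL : √3 * L * c ≤ α) {r y : E} (hr : r ∈ interiorDom Z ω)
    (hy : y ∈ interiorDom Z ω) (g h : E) {u : E} (hu : u ∈ Z) :
    c * inner ℝ (F (prox Z ω ω' r (c • g))) (prox Z ω ω' r (c • g) - u)
      ≤ (proxFun ω ω' r u - proxFun ω ω' (prox Z ω ω' r (c • h)) u)
      + (proxFun ω ω' y u
        - proxFun ω ω' (prox Z ω ω' y (c • (F (prox Z ω ω' r (c • g)) - h))) u)
      + 3 * c ^ 2 * M ^ 2 / (2 * α)
      + 7 / 2 * c ^ 2 / α * dualNorm p (g - F r) ^ 2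
      + (7 / 2 * c ^ 2 / α * dualNorm p (h - F (prox Z ω ω' r (c • g))) ^ 2
        - c * inner ℝ (h - F (prox Z ω ω' r (c • g))) (prox Z ω ω' r (c • g) - y)) := by
  have hα := hω.modulus_pos
  have hZne : Z.Nonempty := ⟨r, hr.1⟩
  have h1 := prox_extragradient_le hp hω hZc hZne hr (c • g) (c • h) hu
  have hw := prox_mem hω hZc hZne r (c • g)
  set w := prox Z ω ω' r (c • g)
  have h2 := prox_step_le hp hω hZc hZne hy (c • (F w - h)) hu
  have h3 : dualNorm p (c • h - c • g)
      ≤ c * (L * p (w - r) + M + dualNorm p (h - F w) + dualNorm p (g - F r)) := by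
    have e : c • h - c • g = c • ((F w - F r) + (h - F w) - (g - F r)) := by module
    rw [e]
    refine (dualNorm_smul_le hp hc.le _).trans (mul_le_mul_of_nonneg_left ?_ hc.le)
    have := dualNorm_sub_le hp ((F w - F r) + (h - F w)) (g - F r)
    have := dualNorm_add_le hp (F w - F r) (h - F w)
    have := hF w hw.1 r hr.1
    linarith
  have h4 : dualNorm p (c • (F w - h)) ≤ c * dualNorm p (h - F w) := by
    rw [← dualNorm_neg hp (h - F w), neg_sub]
    exact dualNorm_smul_le hp hc.le _
  set a := dualNorm p (h - F w)
  set b := dualNorm p (g - F r)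
  have h5 : dualNorm p (c • h - c • g) ^ 2 / (2 * α)
      ≤ α / 2 * p (w - r) ^ 2 + 3 * c ^ 2 * M ^ 2 / (2 * α) + 3 * c ^ 2 / α * a ^ 2
        + 3 * c ^ 2 / α * b ^ 2 := by
    -- The factor 3 comes from `sq_add_three_le`; this is what makes the L-term fit under α/2 p(w −
    -- r)².
    have e1 : (√3 * L * c) ^ 2 ≤ α ^ 2 := pow_le_pow_left₀ (by positivity) hcL 2
    rw [mul_pow, mul_pow, Real.sq_sqrt (by norm_num)] at e1
    have e2 : dualNorm p (c • h - c • g) ^ 2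
        ≤ α ^ 2 * p (w - r) ^ 2 + 3 * c ^ 2 * M ^ 2 + 6 * c ^ 2 * a ^ 2 + 6 * c ^ 2 * b ^ 2 := by
      calc _ ≤ (c * (L * p (w - r) + M + a + b)) ^ 2 :=
            pow_le_pow_left₀ (dualNorm_nonneg hp _) h3 2
        _ ≤ c ^ 2 * (3 * (L * p (w - r)) ^ 2 + 3 * M ^ 2 + 6 * a ^ 2 + 6 * b ^ 2) := by
            rw [mul_pow]
            exact mul_le_mul_of_nonneg_left (sq_add_three_le _ _ _ _) (sq_nonneg c)
        _ = (3 * L ^ 2 * c ^ 2) * p (w - r) ^ 2 + 3 * c ^ 2 * M ^ 2 + 6 * c ^ 2 * a ^ 2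
            + 6 * c ^ 2 * b ^ 2 := by ring
        _ ≤ _ := by
            have := mul_le_mul_of_nonneg_right e1 (sq_nonneg (p (w - r)))
            linarith
    calc _ ≤ (α ^ 2 * p (w - r) ^ 2 + 3 * c ^ 2 * M ^ 2 + 6 * c ^ 2 * a ^ 2
          + 6 * c ^ 2 * b ^ 2) / (2 * α) := div_le_div_of_nonneg_right e2 (by positivity)
      _ = _ := by field_simp; ring
  have h6 : dualNorm p (c • (F w - h)) ^ 2 / (2 * α) ≤ c ^ 2 / (2 * α) * a ^ 2 := by
    calc _ ≤ (c * a) ^ 2 / (2 * α) :=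
          div_le_div_of_nonneg_right (pow_le_pow_left₀ (dualNorm_nonneg hp _) h4 2)
            (by positivity)
      _ = _ := by ring
  have h7 : 7 / 2 * c ^ 2 / α * a ^ 2 = 3 * c ^ 2 / α * a ^ 2 + c ^ 2 / (2 * α) * a ^ 2 := by
    field_simp; ring
  -- The ghost step raises the weight of the error at w from 3 to 7/2; the error at r is given the
  -- same weight so that all 2t calls are treated alike.
  have h8 : 3 * c ^ 2 / α * b ^ 2 ≤ 7 / 2 * c ^ 2 / α * b ^ 2 := by
    gcongr; norm_num
  have e : F w = h + (F w - h) := by abel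
  have e' : w - u = (w - y) + (y - u) := by abel
  have h9 : c * inner ℝ (F w) (w - u) = inner ℝ (c • h) (w - u)
      - c * inner ℝ (h - F w) (w - y) + inner ℝ (c • (F w - h)) (y - u) := by
    rw [real_inner_smul_left, real_inner_smul_left, e', inner_sub_left, inner_sub_left,
      inner_add_right, inner_add_right]
    ring
  rw [h9, h7]
  linarith

theorem mirrorProx_sum_le [FiniteDimensional ℝ E] (hp : IsNorm p) (hω : IsDGF p Z ω ω' α)
    (hZc : IsCompact Z) {L M : ℝ} (hL : 0 ≤ L)
    (hF : ∀ z ∈ Z, ∀ z' ∈ Z, dualNorm p (F z - F z') ≤ L * p (z - z') + M)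
    {c : ℝ} (hc : 0 < c) (hcL : √3 * L * c ≤ α) (hr₀ : r₀ ∈ interiorDom Z ω) {u : E} (hu : u ∈ Z)
    (t : ℕ) :
    c * ∑ τ ∈ Finset.range t, inner ℝ (F (extraPoint Z ω ω' G (fun _ => c) r₀ τ))
        (extraPoint Z ω ω' G (fun _ => c) r₀ τ - u)
      ≤ 2 * proxFun ω ω' r₀ u + t * (3 * c ^ 2 * M ^ 2 / (2 * α))
      + ∑ k ∈ Finset.range (2 * t),
        (7 / 2 * c ^ 2 / α * dualNorm p (G k (query Z ω ω' G (fun _ => c) r₀ k)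
            - F (query Z ω ω' G (fun _ => c) r₀ k)) ^ 2
          - c * inner ℝ (G k (query Z ω ω' G (fun _ => c) r₀ k)
            - F (query Z ω ω' G (fun _ => c) r₀ k))
            (testVector Z ω ω' F G (fun _ => c) r₀ k)) := by
  rw [sum_range_two_mul]
  have key : ∀ t : ℕ, c * ∑ τ ∈ Finset.range t, inner ℝ (F (extraPoint Z ω ω' G (fun _ => c) r₀ τ))
        (extraPoint Z ω ω' G (fun _ => c) r₀ τ - u)
      ≤ (proxFun ω ω' r₀ u - proxFun ω ω' (iterate Z ω ω' G (fun _ => c) r₀ t) u)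
      + (proxFun ω ω' r₀ u - proxFun ω ω' (ghost Z ω ω' F G (fun _ => c) r₀ t) u)
      + t * (3 * c ^ 2 * M ^ 2 / (2 * α))
      + ∑ τ ∈ Finset.range t,
        (7 / 2 * c ^ 2 / α * dualNorm p (G (2 * τ) (iterate Z ω ω' G (fun _ => c) r₀ τ)
            - F (iterate Z ω ω' G (fun _ => c) r₀ τ)) ^ 2
          + (7 / 2 * c ^ 2 / α * dualNorm p (G (2 * τ + 1) (extraPoint Z ω ω' G (fun _ => c) r₀ τ)
            - F (extraPoint Z ω ω' G (fun _ => c) r₀ τ)) ^ 2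
          - c * inner ℝ (G (2 * τ + 1) (extraPoint Z ω ω' G (fun _ => c) r₀ τ)
            - F (extraPoint Z ω ω' G (fun _ => c) r₀ τ))
            (extraPoint Z ω ω' G (fun _ => c) r₀ τ - ghost Z ω ω' F G (fun _ => c) r₀ τ))) := by
    intro t
    induction t with
    | zero => simp [iterate, ghost]
    | succ t ih =>
      rw [Finset.sum_range_succ, Finset.sum_range_succ, mul_add, Nat.cast_succ]
      have h := mirrorProx_step_le hp hω hZc hL hF hc hcL
        (iterate_mem (G := G) (γ := fun _ => c) hω hZc hr₀ t)
        (ghost_mem (F := F) (G := G) (γ := fun _ => c) hω hZc hr₀ t)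
        (G (2 * t) (iterate Z ω ω' G (fun _ => c) r₀ t))
        (G (2 * t + 1) (extraPoint Z ω ω' G (fun _ => c) r₀ t)) hu
      rw [← extraPoint_eq (γ := fun _ => c), ← iterate_succ (γ := fun _ => c)] at h
      change _ ≤ _ + (_ - proxFun ω ω' (ghost Z ω ω' F G (fun _ => c) r₀ (t + 1)) u)
        + _ + _ + _ at h
      linarith
  refine (key t).trans ?_
  have h1 := proxFun_nonneg hω (iterate_mem (G := G) (γ := fun _ => c) hω hZc hr₀ t) hu
  have h2 := proxFun_nonneg hω (ghost_mem (F := F) (G := G) (γ := fun _ => c) hω hZc hr₀ t) hu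
  have h3 : ∀ τ : ℕ, (2 * τ + 1) / 2 = τ := fun τ => by omega
  simp only [query, testVector, Nat.mul_mod_right, Nat.mul_add_mod, if_true, h3,
    Nat.mul_div_cancel_left _ (zero_lt_two : 0 < 2), inner_zero_right, mul_zero, sub_zero,
    one_ne_zero, if_false, Nat.one_mod]
  linarith

end Trajectory

/-! ### Error measures controlled by the averaged gap -/

section Gap

variable {E : Type*} [NormedAddCommGroup E] [InnerProductSpace ℝ E]

/-- `Φ` is bounded, at averages of points of `Z`, by the averaged gap of the variational
inequality. -/
structure IsGapBounded (Z : Set E) (F : E → E) (Φ : E → ℝ) : Prop where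
  continuousOn : ContinuousOn Φ Z
  nonneg : ∀ z ∈ Z, 0 ≤ Φ z
  average_le : ∀ t : ℕ, 1 ≤ t → ∀ w : ℕ → E, (∀ τ, w τ ∈ Z) → ∀ B : ℝ,
    (∀ u ∈ Z, ∑ τ ∈ Finset.range t, inner ℝ (F (w τ)) (w τ - u) ≤ B) →
    t * Φ ((t : ℝ)⁻¹ • ∑ τ ∈ Finset.range t, w τ) ≤ B

theorem average_mem {Z : Set E} (hZ : Convex ℝ Z) {t : ℕ} (ht : 1 ≤ t) {w : ℕ → E}
    (hw : ∀ τ, w τ ∈ Z) : (t : ℝ)⁻¹ • ∑ τ ∈ Finset.range t, w τ ∈ Z := by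
  have ht' : (0 : ℝ) < t := by exact_mod_cast ht
  rw [Finset.smul_sum]
  refine hZ.sum_mem (fun _ _ => (inv_pos.2 ht').le) ?_ fun τ _ => hw τ
  rw [Finset.sum_const, Finset.card_range, nsmul_eq_mul, mul_inv_cancel₀ ht'.ne']

theorem isGapBounded_errVI [FiniteDimensional ℝ E] {p : Seminorm ℝ E} (hp : IsNorm p) {Z : Set E}
    (hZne : Z.Nonempty) (hZc : IsCompact Z) {F : E → E} (hFm : IsMonotoneOp Z F)
    {L M : ℝ} (hL : 0 ≤ L)
    (hF : ∀ z ∈ Z, ∀ z' ∈ Z, dualNorm p (F z - F z') ≤ L * p (z - z') + M) :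
    IsGapBounded Z F (errVI Z F) := by
  obtain ⟨z₀, hz₀⟩ := hZne
  obtain ⟨R, hR⟩ : ∃ R, ∀ u ∈ Z, ‖F u‖ ≤ R := by
    obtain ⟨C, hC, hCF⟩ := exists_norm_le_dualNorm hp
    obtain ⟨D, hD⟩ := (hZc.image_of_continuousOn (f := fun u => p (u - z₀))
      ((continuous_seminorm p).comp (by fun_prop)).continuousOn).bddAbove
    refine ⟨C * (L * D + M) + ‖F z₀‖, fun u hu => ?_⟩
    have h1 := hCF (F u - F z₀)
    have h2 := hF u hu z₀ hz₀
    have h3 : p (u - z₀) ≤ D := hD ⟨u, hu, rfl⟩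
    have h4 := mul_le_mul_of_nonneg_left h3 hL
    have h5 := mul_le_mul_of_nonneg_left (h2.trans (by linarith : _ ≤ L * D + M)) hC.le
    have h6 := norm_le_norm_sub_add (F u) (F z₀)
    linarith
  have hR0 : 0 ≤ R := (norm_nonneg _).trans (hR z₀ hz₀)
  obtain ⟨D, hD⟩ := hZc.isBounded.exists_norm_le
  have hbdd : ∀ z, BddAbove ((fun u => (inner ℝ (F u) (z - u) : ℝ)) '' Z) := by
    intro z
    refine ⟨R * (‖z‖ + D), ?_⟩
    rintro _ ⟨u, hu, rfl⟩
    refine (real_inner_le_norm _ _).trans (mul_le_mul (hR u hu) ?_ (norm_nonneg _) hR0)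
    exact (norm_sub_le z u).trans (by linarith [hD u hu])
  refine ⟨?_, fun z hz => ?_, fun t ht w hw B hB => ?_⟩
  · refine (LipschitzWith.of_le_add_mul (Real.toNNReal R) fun z z' => ?_).continuous.continuousOn
    rw [Real.coe_toNNReal _ hR0, dist_eq_norm]
    refine csSup_le ⟨_, z₀, hz₀, rfl⟩ ?_
    rintro _ ⟨u, hu, rfl⟩
    have h1 : (inner ℝ (F u) (z' - u) : ℝ) ≤ errVI Z F z' := le_csSup (hbdd z') ⟨u, hu, rfl⟩
    have h2 := (real_inner_le_norm (F u) (z - z')).trans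
      (mul_le_mul_of_nonneg_right (hR u hu) (norm_nonneg _))
    have e : z - u = (z' - u) + (z - z') := by abel
    simp only
    rw [e, inner_add_right]
    linarith
  · refine (le_of_eq ?_).trans (le_csSup (hbdd z) ⟨z, hz, rfl⟩)
    simp
  · have ht' : (0 : ℝ) < t := by exact_mod_cast ht
    rw [mul_comm, ← le_div_iff₀ ht']
    refine csSup_le ⟨_, z₀, hz₀, rfl⟩ ?_
    rintro _ ⟨u, hu, rfl⟩
    rw [le_div_iff₀ ht']
    refine le_trans (le_of_eq ?_) ((Finset.sum_le_sum (f := fun τ => inner ℝ (F u) (w τ - u))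
      fun τ _ => ?_).trans (hB u hu))
    · rw [← inner_sum, Finset.sum_sub_distrib, Finset.sum_const, Finset.card_range,
        mul_comm, ← real_inner_smul_right, smul_sub, smul_inv_smul₀ ht'.ne', Nat.cast_smul_eq_nsmul]
    · have := hFm (w τ) (hw τ) u hu
      rw [inner_sub_left] at this
      linarith

end Gap

/-! ### Nash variational inequalities -/

section Nash

variable {m : ℕ} {V : Fin m → Type*}

theorem update_mem_pi {Zs : ∀ i, Set (V i)} {z : ∀ j, V j} (hz : z ∈ Set.univ.pi Zs) {i : Fin m}
    {v : V i} (hv : v ∈ Zs i) : Function.update z i v ∈ Set.univ.pi Zs := by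
  intro j _
  rcases eq_or_ne j i with rfl | h
  · simpa using hv
  · simpa [Function.update_of_ne h] using hz j trivial

variable [∀ i, NormedAddCommGroup (V i)]

theorem dist_update_le (z z' : ∀ j, V j) (i : Fin m) (v : V i) :
    dist (Function.update z i v) (Function.update z' i v) ≤ dist z z' := by
  refine (dist_pi_le_iff dist_nonneg).2 fun j => ?_
  rcases eq_or_ne j i with rfl | h
  · simp
  · simpa [Function.update_of_ne h] using dist_le_pi_dist z z' j

variable [∀ i, InnerProductSpace ℝ (V i)] {Zs : ∀ i, Set (V i)} {φ : Fin m → (∀ j, V j) → ℝ}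

theorem IsConvexNash.exists_min (h : IsConvexNash Zs φ) {z : ∀ j, V j}
    (hz : z ∈ Set.univ.pi Zs) (i : Fin m) :
    ∃ v ∈ Zs i, sInf ((fun v => φ i (Function.update z i v)) '' Zs i)
      = φ i (Function.update z i v) ∧
      ∀ v' ∈ Zs i, φ i (Function.update z i v) ≤ φ i (Function.update z i v') := by
  obtain ⟨K, hK⟩ := h.lipschitz i
  have hc : ContinuousOn (fun v => φ i (Function.update z i v)) (Zs i) :=
    hK.continuousOn.comp (by fun_prop) fun v hv => update_mem_pi hz hv
  obtain ⟨v, hv, hmin⟩ := (h.isCompact i).exists_isMinOn ⟨z i, hz i trivial⟩ hc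
  refine ⟨v, hv, ?_, isMinOn_iff.1 hmin⟩
  exact (IsLeast.csInf_eq ⟨⟨v, hv, rfl⟩, by rintro _ ⟨v', hv', rfl⟩; exact isMinOn_iff.1 hmin v' hv'⟩)

theorem IsConvexNash.continuousOn_errN (h : IsConvexNash Zs φ) :
    ContinuousOn (errN Zs φ) (Set.univ.pi Zs) := by
  refine continuousOn_finsetSum _ fun i _ => ?_
  obtain ⟨K, hK⟩ := h.lipschitz i
  refine hK.continuousOn.sub (LipschitzOnWith.continuousOn (K := K) ?_)
  refine LipschitzOnWith.of_le_add_mul K fun z hz z' hz' => ?_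
  obtain ⟨v, hv, h1, h2⟩ := h.exists_min hz i
  obtain ⟨v', hv', h1', h2'⟩ := h.exists_min hz' i
  rw [h1, h1']
  have h3 := hK.le_add_mul (update_mem_pi hz hv') (update_mem_pi hz' hv')
  have h4 := mul_le_mul_of_nonneg_left (dist_update_le z z' i v') K.coe_nonneg
  linarith [h2 v' hv']

theorem IsConvexNash.errN_nonneg (h : IsConvexNash Zs φ) {z : ∀ j, V j}
    (hz : z ∈ Set.univ.pi Zs) : 0 ≤ errN Zs φ z := by
  refine Finset.sum_nonneg fun i _ => ?_
  obtain ⟨v, hv, h1, h2⟩ := h.exists_min hz i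
  have := h2 (z i) (hz i trivial)
  rw [Function.update_eq_self] at this
  rw [h1]
  linarith

/-- Convexity of the sum and concavity in the others' strategies move the error from the average to
the points w τ; there the blockwise subgradient inequalities sum to the gap. -/
theorem isGapBounded_errN {E : Type*} [NormedAddCommGroup E] [InnerProductSpace ℝ E]
    {e : E ≃ₗᵢ[ℝ] PiLp 2 V} {Z : Set E} (hZv : Convex ℝ Z) {F : E → E}
    (h : IsNashVI e Z F Zs φ) :
    IsGapBounded Z F (fun z => errN Zs φ (fun j => e z j)) := by
  have hN := h.isConvexNash
  have hmem : ∀ z ∈ Z, (fun j => e z j) ∈ Set.univ.pi Zs := fun z hz j _ => (h.mem_iff z).1 hz j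
  refine ⟨?_, fun z hz => hN.errN_nonneg (hmem z hz), fun t ht w hw B hB => ?_⟩
  · refine hN.continuousOn_errN.comp (Continuous.continuousOn ?_) hmem
    exact (PiLp.continuous_ofLp 2 V).comp e.continuous
  · have ht' : (0 : ℝ) < t := by exact_mod_cast ht
    have hz := average_mem hZv ht hw
    set z : E := (t : ℝ)⁻¹ • ∑ τ ∈ Finset.range t, w τ with hzdef
    choose v hv h1 _ using hN.exists_min (hmem z hz)
    -- The comparison point collects the best responses of all players to the averaged point; it is
    -- the same for every τ.
    set u : E := e.symm (WithLp.toLp 2 v) with hu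
    have heu : ∀ i, e u i = v i := fun i => by rw [hu, e.apply_symm_apply]
    have huZ : u ∈ Z := (h.mem_iff u).2 fun i => by rw [heu]; exact hv i
    refine le_trans ?_ (hB u huZ)
    have hw1 : ∑ τ ∈ Finset.range t, (t : ℝ)⁻¹ = 1 := by
      rw [Finset.sum_const, Finset.card_range, nsmul_eq_mul, mul_inv_cancel₀ ht'.ne']
    have hez : (fun j => e z j) = ∑ τ ∈ Finset.range t, (t : ℝ)⁻¹ • (fun j => e (w τ) j) := by
      funext j
      rw [hzdef, map_smul, map_sum, Finset.smul_sum]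
      simp [Finset.sum_apply]
    have hez' : ∀ i, Function.update (fun j => e z j) i (v i)
        = ∑ τ ∈ Finset.range t, (t : ℝ)⁻¹ • Function.update (fun j => e (w τ) j) i (v i) := by
      intro i
      funext j
      rcases eq_or_ne j i with rfl | hj
      · simp [← Nat.cast_smul_eq_nsmul ℝ, smul_inv_smul₀ ht'.ne']
      · rw [Function.update_of_ne hj, congrFun hez j]
        simp [Function.update_of_ne hj]
    have hconv : ∑ i, φ i (fun j => e z j)
        ≤ ∑ τ ∈ Finset.range t, (t : ℝ)⁻¹ * ∑ i, φ i (fun j => e (w τ) j) := by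
      rw [hez]
      exact hN.convex_sum.map_sum_le (fun _ _ => (inv_pos.2 ht').le) hw1
        fun τ _ => hmem _ (hw τ)
    have hconc : ∀ i, ∑ τ ∈ Finset.range t,
        (t : ℝ)⁻¹ * φ i (Function.update (fun j => e (w τ) j) i (v i))
        ≤ φ i (Function.update (fun j => e z j) i (v i)) := by
      intro i
      rw [hez']
      exact (hN.concave_others i (v i) (hv i)).le_map_sum (fun _ _ => (inv_pos.2 ht').le) hw1
        fun τ _ => ⟨update_mem_pi (hmem _ (hw τ)) (hv i), Function.update_self _ _ _⟩
    have hgap : ∀ τ, ∑ i, (φ i (fun j => e (w τ) j)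
        - φ i (Function.update (fun j => e (w τ) j) i (v i)))
        ≤ inner ℝ (F (w τ)) (w τ - u) := by
      intro τ
      rw [← e.inner_map_map, PiLp.inner_apply]
      refine Finset.sum_le_sum fun i _ => ?_
      have := h.mem_subdiff (w τ) (hw τ) i (v i) (hv i)
      simp only [Function.update_eq_self] at this
      rw [map_sub, PiLp.sub_apply, heu, ← neg_sub (v i), inner_neg_right]
      linarith
    calc t * errN Zs φ (fun j => e z j)
        = t * (∑ i, φ i (fun j => e z j)
          - ∑ i, φ i (Function.update (fun j => e z j) i (v i))) := by
          unfold errN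
          rw [Finset.sum_sub_distrib]
          simp only [h1]
      _ ≤ t * (∑ τ ∈ Finset.range t, (t : ℝ)⁻¹ * ∑ i, φ i (fun j => e (w τ) j)
          - ∑ i, ∑ τ ∈ Finset.range t,
            (t : ℝ)⁻¹ * φ i (Function.update (fun j => e (w τ) j) i (v i))) :=
          mul_le_mul_of_nonneg_left
            (sub_le_sub hconv (Finset.sum_le_sum fun i _ => hconc i)) ht'.le
      _ = ∑ τ ∈ Finset.range t, ∑ i, (φ i (fun j => e (w τ) j)
          - φ i (Function.update (fun j => e (w τ) j) i (v i))) := by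
          rw [Finset.sum_comm, ← Finset.sum_sub_distrib, Finset.mul_sum]
          refine Finset.sum_congr rfl fun τ _ => ?_
          rw [← Finset.mul_sum, ← mul_sub, mul_inv_cancel_left₀ ht'.ne', Finset.sum_sub_distrib]
      _ ≤ _ := Finset.sum_le_sum fun τ _ => hgap τ

end Nash

/-! ### Integrating out the noise one term at a time -/

section Sequential

variable {S : Type*}

/-- The sequence whose terms with an index `≥ k` are replaced by a default value. -/
def trunc [Inhabited S] (k : ℕ) (s : ℕ → S) : ℕ → S := fun i => if i < k then s i else default

theorem trunc_zero [Inhabited S] (s : ℕ → S) : trunc 0 s = fun _ => default := by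
  funext i
  simp [trunc]

variable [MeasurableSpace S]

theorem measurable_update_prod (k : ℕ) :
    Measurable fun q : (ℕ → S) × S => Function.update q.1 k q.2 := by
  refine measurable_pi_iff.2 fun i => ?_
  rcases eq_or_ne i k with rfl | h
  · simpa using measurable_snd
  · simp only [Function.update_of_ne h]
    exact (measurable_pi_apply i).comp measurable_fst

/-- Fubini for the finite tuple of the first k terms and the independent k-th one; truncation keeps
everything a function of finitely many coordinates. -/
theorem integral_trunc_succ [Inhabited S] {Ω₀ : Type*} [MeasurableSpace Ω₀] {Pr : Measure Ω₀}
    [IsProbabilityMeasure Pr] {ζ : ℕ → Ω₀ → S} (hζ : ∀ i, Measurable (ζ i))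
    (hindep : iIndepFun ζ Pr) {ν : Measure S} {k : ℕ} (hν : Pr.map (ζ k) = ν)
    {X : (ℕ → S) → ℝ} (hX : Measurable X) {C : ℝ} (hXC : ∀ s, |X s| ≤ C) :
    ∫ x, X (trunc (k + 1) fun i => ζ i x) ∂Pr
      = ∫ x, ∫ a, X (Function.update (trunc k fun i => ζ i x) k a) ∂ν ∂Pr := by
  set H : Ω₀ → (Finset.range k → S) := fun x i => ζ i x with hH
  set ext : (Finset.range k → S) → ℕ → S :=
    fun h i => if hi : i ∈ Finset.range k then h ⟨i, hi⟩ else default with hext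
  have hHm : Measurable H := measurable_pi_iff.2 fun i => hζ i
  have hextm : Measurable ext := by
    refine measurable_pi_iff.2 fun i => ?_
    by_cases hi : i ∈ Finset.range k
    · simp only [hext, hi, dif_pos]
      exact measurable_pi_apply (⟨i, hi⟩ : Finset.range k)
    · simp only [hext, hi, dif_neg, not_false_eq_true]
      exact measurable_const
  have hind : IndepFun H (ζ k) Pr :=
    (hindep.indepFun_finset (Finset.range k) {k} (by simp) hζ).comp measurable_id
      (measurable_pi_apply (⟨k, Finset.mem_singleton_self k⟩ : ({k} : Finset ℕ)))
  have hmap := hind.map_prod_eq_prod_map_map hHm.aemeasurable (hζ k).aemeasurable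
  set f : (Finset.range k → S) × S → ℝ := fun q => X (Function.update (ext q.1) k q.2) with hf
  have hfm : Measurable f := hX.comp
    ((measurable_update_prod k).comp ((hextm.comp measurable_fst).prodMk measurable_snd))
  have hprob : IsProbabilityMeasure ν := hν ▸ Measure.isProbabilityMeasure_map (hζ k).aemeasurable
  have hprob' : IsProbabilityMeasure (Pr.map H) :=
    Measure.isProbabilityMeasure_map hHm.aemeasurable
  have e1 : ∀ x, (trunc k fun i => ζ i x) = ext (H x) := fun x => by
    funext i
    by_cases hi : i < k <;> simp [trunc, hext, hH, hi]
  have e2 : ∀ x, (trunc (k + 1) fun i => ζ i x) = Function.update (ext (H x)) k (ζ k x) := by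
    intro x
    funext i
    rcases lt_trichotomy i k with hi | rfl | hi
    · simp [trunc, hext, hH, hi, hi.ne, Nat.lt_succ_of_lt hi]
    · simp [trunc]
    · simp [trunc, hext, hi.ne', not_lt.2 hi.le, show ¬ i < k + 1 by omega]
  have hfi : Integrable f ((Pr.map H).prod ν) :=
    Integrable.of_bound hfm.aestronglyMeasurable C (ae_of_all _ fun q => hXC _)
  calc ∫ x, X (trunc (k + 1) fun i => ζ i x) ∂Pr
      = ∫ x, f (H x, ζ k x) ∂Pr := by simp only [e2, hf]
    _ = ∫ q, f q ∂(Pr.map fun x => (H x, ζ k x)) :=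
        (integral_map (hHm.prodMk (hζ k)).aemeasurable hfm.aestronglyMeasurable).symm
    _ = ∫ h, ∫ a, f (h, a) ∂ν ∂(Pr.map H) := by
        rw [hmap, hν, integral_prod _ hfi]
    _ = ∫ x, ∫ a, f (H x, a) ∂ν ∂Pr :=
        integral_map hHm.aemeasurable
          hfm.stronglyMeasurable.integral_prod_right'.aestronglyMeasurable
    _ = _ := by simp only [e1, hf]

/-- `U k` does not increase, on average, when the `k`-th term of the sequence is drawn from `ν`.
No measurability in the other terms is required. -/
def IsSequentialSuper (ν : Measure S) (K : ℕ) (U : ℕ → (ℕ → S) → ℝ) : Prop :=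
  ∀ k < K, ∀ s, Integrable (fun a => U (k + 1) (Function.update s k a)) ν ∧
    ∫ a, U (k + 1) (Function.update s k a) ∂ν ≤ U k s

theorem IsSequentialSuper.add {ν : Measure S} {K : ℕ} {U U' : ℕ → (ℕ → S) → ℝ}
    (h : IsSequentialSuper ν K U) (h' : IsSequentialSuper ν K U') :
    IsSequentialSuper ν K fun k s => U k s + U' k s := fun k hk s =>
  ⟨(h k hk s).1.add (h' k hk s).1, by
    rw [integral_add (h k hk s).1 (h' k hk s).1]
    exact add_le_add (h k hk s).2 (h' k hk s).2⟩

/-- Backward induction: integrating the last term out of X gives a bounded measurable function of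
the earlier ones, still below U. Only X is ever integrated over the probability space. -/
theorem IsSequentialSuper.integral_le [Inhabited S] {Ω₀ : Type*} [MeasurableSpace Ω₀] {Pr : Measure Ω₀}
    [IsProbabilityMeasure Pr] {ζ : ℕ → Ω₀ → S} (hζ : ∀ i, Measurable (ζ i))
    (hindep : iIndepFun ζ Pr) {ν : Measure S} (hν : ∀ k, Pr.map (ζ k) = ν)
    {K : ℕ} {U : ℕ → (ℕ → S) → ℝ} (hU : IsSequentialSuper ν K U)
    {X : (ℕ → S) → ℝ} (hX : Measurable X) {C : ℝ} (hXC : ∀ s, |X s| ≤ C)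
    (hXU : ∀ s, X s ≤ U K s) :
    ∫ x, X (trunc K fun i => ζ i x) ∂Pr ≤ U 0 fun _ => default := by
  have hprob : IsProbabilityMeasure ν :=
    hν 0 ▸ Measure.isProbabilityMeasure_map (hζ 0).aemeasurable
  have key : ∀ k ≤ K, ∀ X : (ℕ → S) → ℝ, Measurable X → (∀ s, |X s| ≤ C) → (∀ s, X s ≤ U k s) →
      ∫ x, X (trunc k fun i => ζ i x) ∂Pr ≤ U 0 fun _ => default := by
    intro k
    induction k with
    | zero =>
      intro _ X _ _ h
      simpa [trunc_zero] using h _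
    | succ k ih =>
      intro hk X hX hXC h
      rw [integral_trunc_succ hζ hindep (hν k) hX hXC]
      have hm : Measurable fun q : (ℕ → S) × S => X (Function.update q.1 k q.2) :=
        hX.comp (measurable_update_prod k)
      refine ih (by omega) (fun s => ∫ a, X (Function.update s k a) ∂ν)
        hm.stronglyMeasurable.integral_prod_right'.measurable (fun s => ?_) fun s => ?_
      · have := norm_integral_le_of_norm_le_const (μ := ν)
          (f := fun a => X (Function.update s k a)) (ae_of_all _ fun a => hXC _)
        simpa using this
      · obtain ⟨h1, h2⟩ := hU k (by omega) s
        refine le_trans (integral_mono ?_ h1 fun a => h _) h2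
        exact Integrable.of_bound (hm.comp measurable_prodMk_left).aestronglyMeasurable C
          (ae_of_all _ fun a => hXC _)
  exact key K le_rfl X hX hXC hXU

variable {ν : Measure S} {K : ℕ} {D : ℕ → (ℕ → S) → S → ℝ} {c : ℕ → ℝ}

/-- The potential is the realized partial sum plus the mean budget of the calls to come. -/
theorem isSequentialSuper_sum [IsProbabilityMeasure ν]
    (hD : ∀ k s s', (∀ i < k, s i = s' i) → D k s = D k s')
    (hc : ∀ k < K, ∀ s, Integrable (D k s) ν ∧ ∫ a, D k s a ∂ν ≤ c k) (C : ℝ) :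
    IsSequentialSuper ν K fun k s => C + ∑ j ∈ Finset.range k, D j s (s j)
      + ∑ j ∈ Finset.Ico k K, c j := by
  intro k hk s
  have e : ∀ a, C + ∑ j ∈ Finset.range (k + 1),
      D j (Function.update s k a) (Function.update s k a j) + ∑ j ∈ Finset.Ico (k + 1) K, c j
      = (C + ∑ j ∈ Finset.range k, D j s (s j) + ∑ j ∈ Finset.Ico (k + 1) K, c j) + D k s a := by
    intro a
    have h1 : ∀ j ≤ k, D j (Function.update s k a) = D j s := fun j hj =>
      hD j _ _ fun i hi => Function.update_of_ne (by omega) _ _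
    rw [Finset.sum_range_succ, h1 k le_rfl, Function.update_self,
      Finset.sum_congr rfl fun j hj => by
        have := Finset.mem_range.1 hj
        rw [h1 j this.le, Function.update_of_ne this.ne]]
    ring
  obtain ⟨h1, h2⟩ := hc k hk s
  simp only [e]
  refine ⟨(integrable_const _).add h1, ?_⟩
  rw [integral_add (integrable_const _) h1, integral_const, probReal_univ, one_smul,
    Finset.sum_eq_sum_Ico_succ_bot hk]
  linarith

/-- Multiplicative analogue, used for exponential moments. -/
theorem isSequentialSuper_prod (hD : ∀ k s s', (∀ i < k, s i = s' i) → D k s = D k s')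
    (hD0 : ∀ k s a, 0 ≤ D k s a) (hc0 : ∀ k, 0 ≤ c k)
    (hc : ∀ k < K, ∀ s, Integrable (D k s) ν ∧ ∫ a, D k s a ∂ν ≤ c k) {C : ℝ} (hC : 0 ≤ C) :
    IsSequentialSuper ν K fun k s => C * (∏ j ∈ Finset.range k, D j s (s j))
      * ∏ j ∈ Finset.Ico k K, c j := by
  intro k hk s
  have e : ∀ a, C * (∏ j ∈ Finset.range (k + 1),
      D j (Function.update s k a) (Function.update s k a j)) * ∏ j ∈ Finset.Ico (k + 1) K, c j
      = (C * (∏ j ∈ Finset.range k, D j s (s j)) * ∏ j ∈ Finset.Ico (k + 1) K, c j) * D k s a := by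
    intro a
    have h1 : ∀ j ≤ k, D j (Function.update s k a) = D j s := fun j hj =>
      hD j _ _ fun i hi => Function.update_of_ne (by omega) _ _
    rw [Finset.prod_range_succ, h1 k le_rfl, Function.update_self,
      Finset.prod_congr rfl fun j hj => by
        have := Finset.mem_range.1 hj
        rw [h1 j this.le, Function.update_of_ne this.ne]]
    ring
  obtain ⟨h1, h2⟩ := hc k hk s
  simp only [e]
  refine ⟨h1.const_mul _, ?_⟩
  rw [integral_const_mul, Finset.prod_eq_prod_Ico_succ_bot hk]
  have h3 : 0 ≤ C * (∏ j ∈ Finset.range k, D j s (s j)) * ∏ j ∈ Finset.Ico (k + 1) K, c j :=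
    mul_nonneg (mul_nonneg hC (Finset.prod_nonneg fun j _ => hD0 _ _ _))
      (Finset.prod_nonneg fun j _ => hc0 j)
  refine (mul_le_mul_of_nonneg_left h2 h3).trans (le_of_eq ?_)
  ring

end Sequential

/-! ### Exponential moments of a single oracle error -/

section Noise

theorem exp_le_add_exp_sq (x : ℝ) : Real.exp x ≤ x + Real.exp (x ^ 2) := by
  have h1 : 1 + x ^ 2 ≤ Real.exp (x ^ 2) := by linarith [Real.add_one_le_exp (x ^ 2)]
  rcases le_or_gt |x| 1 with h | h
  · have := Real.abs_exp_sub_one_sub_id_le h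
    linarith [(abs_le.1 this).2]
  · rcases lt_abs.1 h with h | h
    · have : Real.exp x ≤ Real.exp (x ^ 2) := Real.exp_le_exp.2 (by nlinarith)
      linarith
    · have : Real.exp x ≤ 1 := Real.exp_le_one_iff.2 (by linarith)
      nlinarith

/-- A pointwise form of Jensen's inequality: integrated against E exp(Y) ≤ e, the right-hand side
becomes at most exp c. -/
theorem exp_mul_le_of_le_one {c : ℝ} (hc0 : 0 ≤ c) (hc1 : c ≤ 1) (y : ℝ) :
    Real.exp (c * y) ≤ c * Real.exp c * Real.exp (-1) * Real.exp y + (1 - c) * Real.exp c := by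
  have h := convexOn_exp.2 (Set.mem_univ (y - 1)) (Set.mem_univ 0) hc0 (by linarith : 0 ≤ 1 - c)
    (by ring)
  simp only [smul_eq_mul, mul_zero, add_zero, Real.exp_zero, mul_one] at h
  have h2 : Real.exp (c * y) = Real.exp c * Real.exp (c * (y - 1)) := by
    rw [← Real.exp_add]; ring_nf
  rw [h2]
  refine (mul_le_mul_of_nonneg_left h (Real.exp_pos c).le).trans (le_of_eq ?_)
  rw [sub_eq_add_neg y, Real.exp_add]
  ring

variable {S : Type*} [MeasurableSpace S] {ν : Measure S} [IsProbabilityMeasure ν]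

theorem integral_exp_mul_le {Y : S → ℝ} (hY : Measurable Y) (hY0 : ∀ a, 0 ≤ Y a)
    (hi : Integrable (fun a => Real.exp (Y a)) ν) (he : ∫ a, Real.exp (Y a) ∂ν ≤ Real.exp 1)
    {c : ℝ} (hc0 : 0 ≤ c) (hc1 : c ≤ 1) :
    Integrable (fun a => Real.exp (c * Y a)) ν ∧ ∫ a, Real.exp (c * Y a) ∂ν ≤ Real.exp c := by
  have h1 : Integrable (fun a => Real.exp (c * Y a)) ν := by
    refine hi.mono' (by fun_prop) (ae_of_all _ fun a => ?_)
    rw [Real.norm_eq_abs, Real.abs_exp]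
    exact Real.exp_le_exp.2 (mul_le_of_le_one_left (hY0 a) hc1)
  refine ⟨h1, ?_⟩
  have h2 : Integrable (fun a => c * Real.exp c * Real.exp (-1) * Real.exp (Y a)
      + (1 - c) * Real.exp c) ν := (hi.const_mul _).add (integrable_const _)
  refine (integral_mono h1 h2 fun a => exp_mul_le_of_le_one hc0 hc1 (Y a)).trans ?_
  rw [integral_add (hi.const_mul _) (integrable_const _), integral_const_mul, integral_const,
    probReal_univ, one_smul]
  have h3 := mul_le_mul_of_nonneg_left he
    (by positivity : 0 ≤ c * Real.exp c * Real.exp (-1))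
  have h4 : c * Real.exp c * Real.exp (-1) * Real.exp 1 = c * Real.exp c := by
    rw [mul_assoc, ← Real.exp_add]; simp
  linarith

variable {E : Type*} [NormedAddCommGroup E] [InnerProductSpace ℝ E] [FiniteDimensional ℝ E]
  [MeasurableSpace E] [BorelSpace E] {p : Seminorm ℝ E} {n : S → E}

theorem integrable_of_integrable_dualNorm_sq (hp : IsNorm p) (hn : Measurable n)
    (hi : Integrable (fun a => dualNorm p (n a) ^ 2) ν) : Integrable n ν := by
  obtain ⟨C, hC, h⟩ := exists_norm_le_dualNorm hp
  refine ((hi.add (integrable_const 1)).const_mul C).mono' hn.aestronglyMeasurable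
    (ae_of_all _ fun a => (h _).trans (mul_le_mul_of_nonneg_left ?_ hC.le))
  simp only [Pi.add_apply]
  nlinarith [sq_nonneg (dualNorm p (n a) - 1)]

theorem integral_neg_inner_le (hp : IsNorm p) (hn : Measurable n)
    (hi : Integrable (fun a => dualNorm p (n a) ^ 2) ν) {μ R : ℝ} (hμ : 0 ≤ μ)
    (hb : dualNorm p (∫ a, n a ∂ν) ≤ μ) {v : E} (hv : p v ≤ R) :
    Integrable (fun a => -(inner ℝ (n a) v : ℝ)) ν ∧ ∫ a, -(inner ℝ (n a) v : ℝ) ∂ν ≤ μ * R := by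
  have h1 := integrable_of_integrable_dualNorm_sq hp hn hi
  refine ⟨(h1.inner_const v).neg, ?_⟩
  have h2 : ∫ a, (inner ℝ (n a) v : ℝ) ∂ν = inner ℝ (∫ a, n a ∂ν) v := by
    simp_rw [real_inner_comm v]
    exact integral_inner h1 v
  rw [integral_neg, h2]
  have h3 := (abs_le.1 (abs_inner_le_dualNorm_mul hp (∫ a, n a ∂ν) v)).1
  have h4 := mul_le_mul hb hv (apply_nonneg p v) hμ
  linarith

theorem integral_exp_neg_inner_le (hp : IsNorm p) (hn : Measurable n) {μ M R : ℝ} (hμ : 0 ≤ μ)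
    (hM : 0 < M)
    (hi : Integrable (fun a => dualNorm p (n a) ^ 2) ν)
    (hb : dualNorm p (∫ a, n a ∂ν) ≤ μ)
    (hei : Integrable (fun a => Real.exp (dualNorm p (n a) ^ 2 / M ^ 2)) ν)
    (he : ∫ a, Real.exp (dualNorm p (n a) ^ 2 / M ^ 2) ∂ν ≤ Real.exp 1)
    {v : E} (hv : p v ≤ R) {θ : ℝ} (hθ : 0 ≤ θ) :
    Integrable (fun a => Real.exp (-(θ * inner ℝ (n a) v))) ν ∧
      ∫ a, Real.exp (-(θ * inner ℝ (n a) v)) ∂ν ≤ Real.exp (θ * μ * R + θ ^ 2 * R ^ 2 * M ^ 2) := by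
  have hR : 0 ≤ R := (apply_nonneg p v).trans hv
  set Y : S → ℝ := fun a => dualNorm p (n a) ^ 2 / M ^ 2 with hYdef
  have hdm : Measurable fun a => dualNorm p (n a) := (continuous_dualNorm hp).measurable.comp hn
  have hY : Measurable Y := (hdm.pow_const 2).div_const _
  have hY0 : ∀ a, 0 ≤ Y a := fun a => by positivity
  set x : S → ℝ := fun a => -(θ * inner ℝ (n a) v) with hx
  set c : ℝ := θ ^ 2 * R ^ 2 * M ^ 2 with hc
  have hc0 : 0 ≤ c := by positivity
  have hxm : Measurable x := by
    have : Measurable fun a => (inner ℝ (n a) v : ℝ) :=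
      (continuous_id.inner continuous_const : Continuous fun y : E => (inner ℝ y v : ℝ)).measurable.comp hn
    exact (this.const_mul θ).neg
  have hxsq : ∀ a, x a ^ 2 ≤ c * Y a := fun a => by
    have h1 := (abs_inner_le_dualNorm_mul hp (n a) v).trans
      (mul_le_mul_of_nonneg_left hv (dualNorm_nonneg hp _))
    have h2 := sq_le_sq' (by linarith [(abs_le.1 h1).1]) (abs_le.1 h1).2
    calc x a ^ 2 = θ ^ 2 * (inner ℝ (n a) v) ^ 2 := by rw [hx]; ring
      _ ≤ θ ^ 2 * (dualNorm p (n a) * R) ^ 2 := mul_le_mul_of_nonneg_left h2 (sq_nonneg θ)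
      _ = c * Y a := by rw [hc, hYdef]; field_simp
  have hxY : ∀ a, x a ≤ c / 2 + 1 / 2 * Y a := fun a => by
    have h1 := hxsq a
    refine le_of_sq_le_sq ?_ (by have := hY0 a; positivity)
    nlinarith [sq_nonneg (c - Y a)]
  obtain ⟨hi2, he2⟩ := integral_exp_mul_le hY hY0 hei he (c := 1 / 2) (by norm_num) (by norm_num)
  have hmaj : Integrable (fun a => Real.exp (c / 2) * Real.exp (1 / 2 * Y a)) ν := hi2.const_mul _
  have hle : ∀ a, Real.exp (x a) ≤ Real.exp (c / 2) * Real.exp (1 / 2 * Y a) := fun a => by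
    rw [← Real.exp_add]; exact Real.exp_le_exp.2 (hxY a)
  have hint : Integrable (fun a => Real.exp (x a)) ν :=
    hmaj.mono' hxm.exp.aestronglyMeasurable (ae_of_all _ fun a => by
      rw [Real.norm_eq_abs, Real.abs_exp]; exact hle a)
  refine ⟨hint, ?_⟩
  have hμR : 0 ≤ θ * μ * R := by positivity
  -- For c ≤ 1, exp x ≤ x + exp(x²) ≤ x + exp(cY), so only the mean of x enters linearly. For c > 1
  -- the bound x ≤ (c + Y)/2 gives exp(c/2 + 1/2) ≤ exp c.
  rcases le_or_gt c 1 with hc1 | hc1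
  · obtain ⟨hi3, he3⟩ := integral_exp_mul_le hY hY0 hei he hc0 hc1
    obtain ⟨hi4, he4⟩ := integral_neg_inner_le hp hn hi hμ hb hv
    have hi5 : Integrable x ν := (hi4.const_mul θ).congr (ae_of_all _ fun a => by
      simp only [hx]; ring)
    have he5 : ∫ a, x a ∂ν ≤ θ * μ * R := by
      have : ∫ a, x a ∂ν = θ * ∫ a, -(inner ℝ (n a) v : ℝ) ∂ν := by
        rw [← integral_const_mul]
        exact integral_congr_ae (ae_of_all _ fun a => by simp only [hx]; ring)
      rw [this, mul_assoc]
      exact mul_le_mul_of_nonneg_left he4 hθ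
    calc ∫ a, Real.exp (x a) ∂ν ≤ ∫ a, (x a + Real.exp (c * Y a)) ∂ν :=
          integral_mono hint (hi5.add hi3) fun a => (exp_le_add_exp_sq _).trans
            (add_le_add_right (Real.exp_le_exp.2 (hxsq a)) _)
      _ ≤ θ * μ * R + Real.exp c := by
          rw [integral_add hi5 hi3]; exact add_le_add he5 he3
      _ ≤ Real.exp (θ * μ * R + c) := by
          rw [Real.exp_add]
          have h1 := Real.add_one_le_exp (θ * μ * R)
          have h2 := Real.one_le_exp hc0
          nlinarith
  · calc ∫ a, Real.exp (x a) ∂ν ≤ ∫ a, Real.exp (c / 2) * Real.exp (1 / 2 * Y a) ∂ν :=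
          integral_mono hint hmaj hle
      _ ≤ Real.exp (c / 2) * Real.exp (1 / 2) := by
          rw [integral_const_mul]
          exact mul_le_mul_of_nonneg_left he2 (Real.exp_pos _).le
      _ ≤ Real.exp (θ * μ * R + c) := by
          rw [← Real.exp_add]
          exact Real.exp_le_exp.2 (by linarith)

end Noise

/-! ### Numerical consequences of the stepsize -/

section StepSize

/-- Whichever term attains the minimum, αΩ² is matched by the corresponding summand. The constants
are √3 ≤ 7/4 and √(2/21) ≈ 0.3086, which lies between 4/13 and 31/100. -/
theorem optimalStep_bounds {α L M Ω γ : ℝ} {t : ℕ} (hα : 0 < α) (hL : 0 ≤ L) (hM : 0 ≤ M)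
    (hΩ : 0 ≤ Ω) (ht : 1 ≤ t) (hγ : 0 < γ)
    (hstep : ENNReal.ofReal γ = optimalStep α L M Ω t) :
    √3 * L * γ ≤ α ∧ α * Ω ^ 2 ≤ γ * (7 / 4 * (Ω ^ 2 * L) + 13 / 4 * (Ω * M * √t)) ∧
      t * (γ ^ 2 * M ^ 2 / α) ≤ γ * (31 / 100 * (Ω * M * √t)) ∧ (0 < M → 0 < Ω) := by
  have ht' : (0 : ℝ) < t := by exact_mod_cast ht
  set T : ℝ := √t with hT
  have hTpos : 0 < T := Real.sqrt_pos.2 ht'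
  have hTsq : T ^ 2 = t := Real.sq_sqrt ht'.le
  set b : ℝ := √(2 / (21 * (t : ℝ))) with hb
  have hbpos : 0 < b := Real.sqrt_pos.2 (by positivity)
  have hbT : (b * T) ^ 2 = 2 / 21 := by
    rw [mul_pow, hTsq, hb, Real.sq_sqrt (by positivity)]
    field_simp
  have hbT1 : b * T ≤ 31 / 100 := by
    refine le_of_sq_le_sq ?_ (by norm_num)
    rw [hbT]; norm_num
  have hbT2 : 1 ≤ 13 / 4 * (b * T) := by
    refine le_of_sq_le_sq ?_ (by positivity)
    rw [mul_pow, hbT]; norm_num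
  have h3 : √3 ≤ 7 / 4 := Real.sqrt_le_iff.2 ⟨by norm_num, by norm_num⟩
  have h3pos : 0 < √3 := Real.sqrt_pos.2 (by norm_num)
  have hsecond : 0 < M → ENNReal.ofReal (α * Ω) / ENNReal.ofReal M * ENNReal.ofReal b
      = ENNReal.ofReal (α * Ω / M * b) := fun h => by
    rw [← ENNReal.ofReal_div_of_pos h, ← ENNReal.ofReal_mul (by positivity)]
  have hle1 : √3 * L * γ ≤ α := by
    have h : ENNReal.ofReal γ ≤ ENNReal.ofReal α / ENNReal.ofReal (√3 * L) :=
      hstep.trans_le (min_le_left _ _)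
    have h := ENNReal.mul_le_of_le_div h
    rw [← ENNReal.ofReal_mul hγ.le, ENNReal.ofReal_le_ofReal_iff hα.le] at h
    linarith
  have hle2 : γ * M ≤ α * Ω * b := by
    rcases hM.eq_or_lt with h | h
    · rw [← h, mul_zero]; positivity
    · have h' : ENNReal.ofReal γ ≤ _ := hstep.trans_le (min_le_right _ _)
      rw [← hb, hsecond h, ENNReal.ofReal_le_ofReal_iff (by positivity), div_mul_eq_mul_div,
        le_div_iff₀ h] at h'
      exact h'
  refine ⟨hle1, ?_, ?_, fun h => ?_⟩
  · rcases min_choice (ENNReal.ofReal α / ENNReal.ofReal (√3 * L))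
      (ENNReal.ofReal (α * Ω) / ENNReal.ofReal M * ENNReal.ofReal b) with hmin | hmin
    · have h : ENNReal.ofReal γ = _ := hstep.trans hmin
      rcases hL.eq_or_lt with h0 | h0
      · rw [← h0, mul_zero, ENNReal.ofReal_zero, ENNReal.div_zero
          (ENNReal.ofReal_pos.2 hα).ne'] at h
        exact absurd h ENNReal.ofReal_ne_top
      · have hden : 0 < √3 * L := by positivity
        rw [← ENNReal.ofReal_div_of_pos hden, ENNReal.ofReal_eq_ofReal_iff hγ.le (by positivity),
          eq_div_iff hden.ne'] at h
        have h1 : √3 * (γ * L * Ω ^ 2) ≤ 7 / 4 * (γ * L * Ω ^ 2) :=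
          mul_le_mul_of_nonneg_right h3 (by positivity)
        have h2 : 0 ≤ γ * (13 / 4 * (Ω * M * T)) := by positivity
        rw [← h]
        linarith
    · have h : ENNReal.ofReal γ = _ := hstep.trans hmin
      rcases hΩ.eq_or_lt with h0 | h0
      · rw [← h0]; simp
      rcases hM.eq_or_lt with h1 | h1
      · rw [← h1, ENNReal.ofReal_zero, ENNReal.div_zero
          (ENNReal.ofReal_pos.2 (mul_pos hα h0)).ne',
          ENNReal.top_mul (ENNReal.ofReal_pos.2 hbpos).ne'] at h
        exact absurd h ENNReal.ofReal_ne_top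
      · rw [hsecond h1, ENNReal.ofReal_eq_ofReal_iff hγ.le (by positivity), div_mul_eq_mul_div,
          eq_div_iff h1.ne'] at h
        have h2 : γ * (13 / 4 * (Ω * M * T)) = α * Ω ^ 2 * (13 / 4 * (b * T)) := by
          linear_combination 13 / 4 * Ω * T * h
        have h3 : α * Ω ^ 2 * 1 ≤ α * Ω ^ 2 * (13 / 4 * (b * T)) :=
          mul_le_mul_of_nonneg_left hbT2 (by positivity)
        have h4 : 0 ≤ γ * (7 / 4 * (Ω ^ 2 * L)) := by positivity
        linarith
  · have h1 : t * (γ ^ 2 * M ^ 2 / α) = T ^ 2 * (γ * M) * (γ * M / α) := by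
      rw [hTsq]; ring
    have h2 : γ * M / α ≤ Ω * b := by
      rw [div_le_iff₀ hα]; linarith
    have h3 : T ^ 2 * (γ * M) * (γ * M / α) ≤ T ^ 2 * (γ * M) * (Ω * b) :=
      mul_le_mul_of_nonneg_left h2 (by positivity)
    have h4 : (γ * M * Ω * T) * (b * T) ≤ (γ * M * Ω * T) * (31 / 100) :=
      mul_le_mul_of_nonneg_left hbT1 (by positivity)
    rw [h1]
    linarith
  · refine lt_of_le_of_ne hΩ fun h0 => ?_
    rw [← h0, mul_zero, zero_mul] at hle2
    exact absurd hle2 (not_le.2 (mul_pos hγ h))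

theorem mul_K₀ {L M μ Ω γ : ℝ} {t : ℕ} (ht : 1 ≤ t) :
    γ * t * K₀ L M μ Ω t
      = γ * (7 / 4 * (Ω ^ 2 * L) + 7 * (Ω * M * √t)) + 2 * γ * μ * Ω * t := by
  have ht' : (0 : ℝ) < t := by exact_mod_cast ht
  have hTpos : 0 < √(t : ℝ) := Real.sqrt_pos.2 ht'
  have hTsq : √(t : ℝ) * √t = t := Real.mul_self_sqrt ht'.le
  unfold K₀
  field_simp
  linear_combination -28 * γ * Ω * M * hTsq

theorem mul_K₁ {M Ω γ : ℝ} {t : ℕ} (ht : 1 ≤ t) :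
    γ * t * K₁ M Ω t = γ * (7 / 2 * (Ω * M * √t)) := by
  have ht' : (0 : ℝ) < t := by exact_mod_cast ht
  have hTpos : 0 < √(t : ℝ) := Real.sqrt_pos.2 ht'
  have hTsq : √(t : ℝ) * √t = t := Real.mul_self_sqrt ht'.le
  unfold K₁
  field_simp
  linear_combination -γ * Ω * M * hTsq

end StepSize

/-! ### Measurability of the trajectory and the law of the noise -/

section Oracle

variable {E S : Type*} {Ξ : E → S → E}

/-- The answers of the oracle along a realization of the noise. -/
def oracle (Ξ : E → S → E) (s : ℕ → S) : ℕ → E → E := fun k z => Ξ z (s k)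

theorem oracle_eq_of_lt {s s' : ℕ → S} {k : ℕ} (h : ∀ i < k, s i = s' i) :
    ∀ j < k, oracle Ξ s j = oracle Ξ s' j := fun j hj => by
  unfold oracle
  rw [h j hj]

theorem output_trunc [NormedAddCommGroup E] [InnerProductSpace ℝ E] [Inhabited S] {Z : Set E}
    {ω : E → ℝ} {ω' : E → E} {γ : ℕ → ℝ} {r₀ : E} (s : ℕ → S) (t : ℕ) :
    output Z ω ω' (oracle Ξ (trunc (2 * t) s)) γ r₀ t = output Z ω ω' (oracle Ξ s) γ r₀ t :=
  output_congr (oracle_eq_of_lt fun i hi => by simp [trunc, hi])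

theorem measurable_oracle [MeasurableSpace E] [MeasurableSpace S] {Z : Set E}
    (hΞ : Measurable fun q : Z × S => Ξ q.1 q.2) {z : (ℕ → S) → E}
    (hz : Measurable z) (hzZ : ∀ s, z s ∈ Z) (k : ℕ) :
    Measurable fun s => oracle Ξ s k (z s) :=
  hΞ.comp ((hz.subtype_mk (h := hzZ)).prodMk (measurable_pi_apply k))

variable {E : Type*} [NormedAddCommGroup E] [InnerProductSpace ℝ E] [FiniteDimensional ℝ E]
  [MeasurableSpace E] [BorelSpace E] {S : Type*} [MeasurableSpace S]
  {p : Seminorm ℝ E} {Z : Set E} {ω : E → ℝ} {ω' : E → E} {α : ℝ} {F : E → E}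
  {Ξ : E → S → E} {r₀ : E} {γ : ℕ → ℝ}

/-- The selection ω' is continuous only on Z^o, so its measurability is used on that subtype, where
the trajectory stays. -/
theorem measurable_prox (hp : IsNorm p) (hω : IsDGF p Z ω ω' α) (hZc : IsCompact Z)
    (hZne : Z.Nonempty) {X : Type*} [MeasurableSpace X] {z ξ : X → E} (hz : Measurable z)
    (hzo : ∀ x, z x ∈ interiorDom Z ω) (hξ : Measurable ξ) :
    Measurable fun x => prox Z ω ω' (z x) (ξ x) := by
  have h1 : Measurable fun x => ω' (z x) :=
    hω.continuousOn_selection.domRestrict.measurable.comp (hz.subtype_mk (h := hzo))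
  exact (continuous_linMin hp hω hZc hZne).measurable.comp (hξ.sub h1)

theorem measurable_extraPoint_of_iterate (hp : IsNorm p) (hω : IsDGF p Z ω ω' α)
    (hZc : IsCompact Z) (hΞ : Measurable fun q : Z × S => Ξ q.1 q.2)
    (hr₀ : r₀ ∈ interiorDom Z ω) {τ : ℕ}
    (h : Measurable fun s => iterate Z ω ω' (oracle Ξ s) γ r₀ τ) :
    Measurable fun s => extraPoint Z ω ω' (oracle Ξ s) γ r₀ τ :=
  measurable_prox hp hω hZc ⟨_, hr₀.1⟩ h (fun _ => iterate_mem hω hZc hr₀ τ)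
    ((measurable_oracle hΞ h (fun _ => (iterate_mem hω hZc hr₀ τ).1) _).const_smul _)

theorem measurable_iterate (hp : IsNorm p) (hω : IsDGF p Z ω ω' α)
    (hZc : IsCompact Z) (hΞ : Measurable fun q : Z × S => Ξ q.1 q.2)
    (hr₀ : r₀ ∈ interiorDom Z ω) (τ : ℕ) :
    Measurable fun s => iterate Z ω ω' (oracle Ξ s) γ r₀ τ := by
  induction τ with
  | zero => exact measurable_const
  | succ τ ih =>
    exact measurable_prox hp hω hZc ⟨_, hr₀.1⟩ ih (fun _ => iterate_mem hω hZc hr₀ τ)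
      ((measurable_oracle hΞ (measurable_extraPoint_of_iterate hp hω hZc hΞ hr₀ ih)
        (fun _ => (extraPoint_mem hω hZc ⟨_, hr₀.1⟩ τ).1) _).const_smul _)

theorem measurable_output (hp : IsNorm p) (hω : IsDGF p Z ω ω' α)
    (hZc : IsCompact Z) (hΞ : Measurable fun q : Z × S => Ξ q.1 q.2)
    (hr₀ : r₀ ∈ interiorDom Z ω) (t : ℕ) :
    Measurable fun s => output Z ω ω' (oracle Ξ s) γ r₀ t := by
  refine (Finset.measurable_sum _ fun τ _ => ?_).const_smul _
  exact (measurable_extraPoint_of_iterate hp hω hZc hΞ hr₀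
    (measurable_iterate hp hω hZc hΞ hr₀ τ)).const_smul _

/-- Measurability, bias and variance of the oracle, in terms of the law of the noise. -/
structure IsOracleNoise (ν : Measure S) (p : Seminorm ℝ E) (Z : Set E) (F : E → E)
    (Ξ : E → S → E) (μ M : ℝ) : Prop where
  measurable : ∀ z ∈ Z, Measurable fun a => Ξ z a - F z
  bias : ∀ z ∈ Z, dualNorm p (∫ a, (Ξ z a - F z) ∂ν) ≤ μ
  integrable : ∀ z ∈ Z, Integrable (fun a => dualNorm p (Ξ z a - F z) ^ 2) ν
  variance : ∀ z ∈ Z, ∫ a, dualNorm p (Ξ z a - F z) ^ 2 ∂ν ≤ M ^ 2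

theorem AssumptionI.isOracleNoise {Ω₀ : Type*} [MeasurableSpace Ω₀] {Pr : Measure Ω₀}
    (hp : IsNorm p) {ζ : ℕ → Ω₀ → S} (hζ : Measurable (ζ 0))
    (hΞ : Measurable fun q : Z × S => Ξ q.1 q.2) {μ M : ℝ}
    (h : AssumptionI Pr p Z F Ξ ζ μ M) :
    IsOracleNoise (Pr.map (ζ 0)) p Z F Ξ μ M := by
  have hm : ∀ z ∈ Z, Measurable fun a => Ξ z a - F z := fun z hz =>
    (hΞ.comp (measurable_const.prodMk measurable_id : Measurable fun a : S =>
      ((⟨z, hz⟩ : Z), a))).sub_const _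
  have hd : ∀ z ∈ Z, Measurable fun a => dualNorm p (Ξ z a - F z) ^ 2 := fun z hz =>
    ((continuous_dualNorm hp).measurable.comp (hm z hz)).pow_const 2
  refine ⟨hm, fun z hz => ?_, fun z hz => ?_, fun z hz => ?_⟩
  · rw [integral_map hζ.aemeasurable (hm z hz).aestronglyMeasurable]
    exact (h z hz 0).1
  · rw [integrable_map_measure (hd z hz).aestronglyMeasurable hζ.aemeasurable]
    exact (h z hz 0).2.1
  · rw [integral_map hζ.aemeasurable (hd z hz).aestronglyMeasurable]
    exact (h z hz 0).2.2

theorem AssumptionII.map {Ω₀ : Type*} [MeasurableSpace Ω₀] {Pr : Measure Ω₀}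
    (hp : IsNorm p) {ζ : ℕ → Ω₀ → S} (hζ : Measurable (ζ 0)) {M : ℝ}
    (hm : ∀ z ∈ Z, Measurable fun a => Ξ z a - F z)
    (h : AssumptionII Pr p Z F Ξ ζ M) {z : E} (hz : z ∈ Z) :
    Integrable (fun a => Real.exp (dualNorm p (Ξ z a - F z) ^ 2 / M ^ 2)) (Pr.map (ζ 0)) ∧
      ∫ a, Real.exp (dualNorm p (Ξ z a - F z) ^ 2 / M ^ 2) ∂(Pr.map (ζ 0)) ≤ Real.exp 1 := by
  have hd : Measurable fun a => Real.exp (dualNorm p (Ξ z a - F z) ^ 2 / M ^ 2) :=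
    ((((continuous_dualNorm hp).measurable.comp (hm z hz)).pow_const 2).div_const _).exp
  rw [integrable_map_measure hd.aestronglyMeasurable hζ.aemeasurable,
    integral_map hζ.aemeasurable hd.aestronglyMeasurable]
  exact h z hz 0

end Oracle

/-! ### Bounds in expectation and in probability -/

section Bounds

theorem sum_ite_even (c : ℝ) (t : ℕ) :
    ∑ k ∈ Finset.range (2 * t), (if k % 2 = 0 then 0 else c) = t * c := by
  rw [sum_range_two_mul]
  simp [Nat.add_mod]

variable {E : Type*} [NormedAddCommGroup E] [InnerProductSpace ℝ E]
  {S : Type*} {p : Seminorm ℝ E} {Z : Set E} {ω : E → ℝ} {ω' : E → E} {α : ℝ} {F : E → E}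
  {Ξ : E → S → E} {γ L M μ : ℝ} {Φ : E → ℝ}

/-- The error of an answer to the `k`-th query, as a function of the noise of this call. -/
def callError (Z : Set E) (ω : E → ℝ) (ω' : E → E) (F : E → E) (Ξ : E → S → E) (γ : ℝ)
    (k : ℕ) (s : ℕ → S) (a : S) : E :=
  Ξ (query Z ω ω' (oracle Ξ s) (fun _ => γ) (center Z ω) k) a
    - F (query Z ω ω' (oracle Ξ s) (fun _ => γ) (center Z ω) k)

/-- The vector against which the error of the `k`-th call is tested. -/
def callTest (Z : Set E) (ω : E → ℝ) (ω' : E → E) (F : E → E) (Ξ : E → S → E) (γ : ℝ)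
    (k : ℕ) (s : ℕ → S) : E :=
  testVector Z ω ω' F (oracle Ξ s) (fun _ => γ) (center Z ω) k

theorem callError_congr {k : ℕ} {s s' : ℕ → S} (h : ∀ i < k, s i = s' i) :
    callError Z ω ω' F Ξ γ k s = callError Z ω ω' F Ξ γ k s' := by
  unfold callError
  rw [query_congr (oracle_eq_of_lt h)]

theorem callTest_congr {k : ℕ} {s s' : ℕ → S} (h : ∀ i < k, s i = s' i) :
    callTest Z ω ω' F Ξ γ k s = callTest Z ω ω' F Ξ γ k s' :=
  testVector_congr (oracle_eq_of_lt h)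

theorem callTest_le [FiniteDimensional ℝ E] (hω : IsDGF p Z ω ω' α) (hZc : IsCompact Z) (hZne : Z.Nonempty)
    (k : ℕ) (s : ℕ → S) :
    p (callTest Z ω ω' F Ξ γ k s) ≤ if k % 2 = 0 then 0 else 2 * radius Z ω ω' α := by
  unfold callTest testVector
  split_ifs
  · simp
  · exact sub_le_two_mul_radius hω hZc hZne (extraPoint_mem hω hZc hZne _).1
      (ghost_mem hω hZc (center_mem hω hZc hZne) _).1

variable [FiniteDimensional ℝ E]

/-- The pathwise bound on the gap of the output. -/
theorem gap_output_le (hp : IsNorm p) (hω : IsDGF p Z ω ω' α) (hZc : IsCompact Z)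
    (hZne : Z.Nonempty) (hL : 0 ≤ L)
    (hF : ∀ z ∈ Z, ∀ z' ∈ Z, dualNorm p (F z - F z') ≤ L * p (z - z') + M)
    (hγ : 0 < γ) (hγL : √3 * L * γ ≤ α) (hΦ : IsGapBounded Z F Φ) {t : ℕ} (ht : 1 ≤ t)
    (s : ℕ → S) :
    γ * t * Φ (output Z ω ω' (oracle Ξ s) (fun _ => γ) (center Z ω) t)
      ≤ α * radius Z ω ω' α ^ 2 + 3 / 2 * (t * (γ ^ 2 * M ^ 2 / α))
      + ∑ k ∈ Finset.range (2 * t),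
        (7 / 2 * γ ^ 2 / α * dualNorm p (callError Z ω ω' F Ξ γ k s (s k)) ^ 2
          - γ * inner ℝ (callError Z ω ω' F Ξ γ k s (s k)) (callTest Z ω ω' F Ξ γ k s)) := by
  have hc := center_mem hω hZc hZne
  rw [output_const hγ.ne', mul_assoc, ← le_div_iff₀' hγ]
  refine hΦ.average_le t ht _ (fun τ => (extraPoint_mem hω hZc hZne τ).1) _ fun u hu => ?_
  rw [le_div_iff₀' hγ]
  refine (mirrorProx_sum_le hp hω hZc hL hF hγ hγL hc hu t).trans ?_
  have h1 := proxFun_le_theta hω hZc (center Z ω) hu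
  -- Iterates and ghost both start at the center, so V(z_c, u) enters twice, at total cost 2Θ = αΩ².
  have h2 := mul_radius_sq hω hZc hZne
  have h3 : (t : ℝ) * (3 * γ ^ 2 * M ^ 2 / (2 * α)) = 3 / 2 * (t * (γ ^ 2 * M ^ 2 / α)) := by
    ring
  rw [h2, h3]
  unfold callError callTest oracle
  linarith

variable [MeasurableSpace E] [BorelSpace E] [MeasurableSpace S]

theorem measurable_gap (hp : IsNorm p) (hω : IsDGF p Z ω ω' α) (hZc : IsCompact Z)
    (hZne : Z.Nonempty) (hZv : Convex ℝ Z) (hΞ : Measurable fun q : Z × S => Ξ q.1 q.2)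
    (hγ : 0 < γ) (hΦ : ContinuousOn Φ Z) {t : ℕ} (ht : 1 ≤ t) :
    Measurable (fun s : ℕ → S => Φ (output Z ω ω' (oracle Ξ s) (fun _ => γ) (center Z ω) t)) ∧
      ∀ s : ℕ → S, output Z ω ω' (oracle Ξ s) (fun _ => γ) (center Z ω) t ∈ Z := by
  have hmem : ∀ s : ℕ → S, output Z ω ω' (oracle Ξ s) (fun _ => γ) (center Z ω) t ∈ Z := by
    intro s
    rw [output_const hγ.ne']
    exact average_mem hZv ht fun τ => (extraPoint_mem hω hZc hZne τ).1
  exact ⟨hΦ.domRestrict.measurable.comp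
    ((measurable_output hp hω hZc hΞ (center_mem hω hZc hZne) t).subtype_mk (h := hmem)), hmem⟩

variable {Ω₀ : Type*} [MeasurableSpace Ω₀] {Pr : Measure Ω₀} [IsProbabilityMeasure Pr]
  [Inhabited S] {ζ : ℕ → Ω₀ → S} {ν : Measure S}

/-- The constant 17/2 is 3/2 from M in the condition on F plus 7/2 for each of the two calls of a
step; the bias acts only on the t odd-numbered calls, whose test vectors have norm at most 2Ω. -/
theorem integral_gap_le (hp : IsNorm p) (hω : IsDGF p Z ω ω' α) (hZc : IsCompact Z)
    (hZne : Z.Nonempty) (hZv : Convex ℝ Z) (hL : 0 ≤ L)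
    (hF : ∀ z ∈ Z, ∀ z' ∈ Z, dualNorm p (F z - F z') ≤ L * p (z - z') + M)
    (hζ : ∀ i, Measurable (ζ i)) (hindep : iIndepFun ζ Pr) (hν : ∀ k, Pr.map (ζ k) = ν)
    (hΞ : Measurable fun q : Z × S => Ξ q.1 q.2) (hμ : 0 ≤ μ)
    (hnoise : IsOracleNoise ν p Z F Ξ μ M)
    (hγ : 0 < γ) (hγL : √3 * L * γ ≤ α) (hΦ : IsGapBounded Z F Φ) {t : ℕ} (ht : 1 ≤ t) :
    Integrable (fun x => Φ (smpOutput Z ω ω' Ξ ζ γ t x)) Pr ∧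
    γ * t * ∫ x, Φ (smpOutput Z ω ω' Ξ ζ γ t x) ∂Pr
      ≤ α * radius Z ω ω' α ^ 2 + 17 / 2 * (t * (γ ^ 2 * M ^ 2 / α))
        + 2 * γ * μ * radius Z ω ω' α * t := by
  have hα := hω.modulus_pos
  have hprob : IsProbabilityMeasure ν :=
    hν 0 ▸ Measure.isProbabilityMeasure_map (hζ 0).aemeasurable
  obtain ⟨hXm, hXZ⟩ := measurable_gap (S := S) (Ξ := Ξ) hp hω hZc hZne hZv hΞ hγ
    hΦ.continuousOn ht
  obtain ⟨B, hB⟩ := hZc.exists_bound_of_continuousOn hΦ.continuousOn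
  have hint : Integrable (fun x => Φ (smpOutput Z ω ω' Ξ ζ γ t x)) Pr :=
    Integrable.of_bound (hXm.comp (measurable_pi_iff.2 hζ)).aestronglyMeasurable B
      (ae_of_all _ fun x => hB _ (hXZ _))
  refine ⟨hint, ?_⟩
  set R : ℕ → ℝ := fun k => if k % 2 = 0 then 0 else 2 * radius Z ω ω' α with hR
  set A : ℝ := 7 / 2 * γ ^ 2 / α with hA
  have hA0 : 0 ≤ A := by positivity
  have hsuper := isSequentialSuper_sum (ν := ν) (K := 2 * t)
    (D := fun k s a => A * dualNorm p (callError Z ω ω' F Ξ γ k s a) ^ 2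
      - γ * inner ℝ (callError Z ω ω' F Ξ γ k s a) (callTest Z ω ω' F Ξ γ k s))
    (c := fun k => A * M ^ 2 + γ * (μ * R k))
    (fun k s s' h => by rw [callError_congr h, callTest_congr h])
    (fun k _ s => by
      have hq : query Z ω ω' (oracle Ξ s) (fun _ => γ) (center Z ω) k ∈ Z :=
        query_mem hω hZc (center_mem hω hZc hZne) k
      have h1 := hnoise.integrable _ hq
      obtain ⟨h2, h3⟩ := integral_neg_inner_le hp (hnoise.measurable _ hq) h1 hμ
        (hnoise.bias _ hq) (callTest_le (F := F) (Ξ := Ξ) (γ := γ) hω hZc hZne k s)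
      have e : ∀ a, A * dualNorm p (callError Z ω ω' F Ξ γ k s a) ^ 2
          - γ * inner ℝ (callError Z ω ω' F Ξ γ k s a) (callTest Z ω ω' F Ξ γ k s)
          = A * dualNorm p (callError Z ω ω' F Ξ γ k s a) ^ 2
          + γ * -inner ℝ (callError Z ω ω' F Ξ γ k s a) (callTest Z ω ω' F Ξ γ k s) := fun a => by
        ring
      simp only [e]
      refine ⟨(h1.const_mul A).add (h2.const_mul γ), ?_⟩
      refine (integral_add (h1.const_mul A) (h2.const_mul γ)).trans_le ?_
      rw [integral_const_mul, integral_const_mul]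
      exact add_le_add (mul_le_mul_of_nonneg_left (hnoise.variance _ hq) hA0)
        (mul_le_mul_of_nonneg_left h3 hγ.le))
    (α * radius Z ω ω' α ^ 2 + 3 / 2 * (t * (γ ^ 2 * M ^ 2 / α)))
  have h := hsuper.integral_le hζ hindep hν
    (X := fun s => γ * t * Φ (output Z ω ω' (oracle Ξ s) (fun _ => γ) (center Z ω) t))
    (hXm.const_mul _) (C := γ * t * B)
    (fun s => by
      rw [abs_mul, abs_of_nonneg (by positivity : 0 ≤ γ * t)]
      exact mul_le_mul_of_nonneg_left (hB _ (hXZ s)) (by positivity))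
    (fun s => by
      simpa using gap_output_le hp hω hZc hZne hL hF hγ hγL hΦ ht s)
  simp only [output_trunc] at h
  rw [integral_const_mul] at h
  refine h.trans (le_of_eq ?_)
  rw [Finset.range_zero, Finset.sum_empty, ← Finset.range_eq_Ico, Finset.sum_add_distrib,
    ← Finset.mul_sum, ← Finset.mul_sum, ← Finset.mul_sum, hR, sum_ite_even, Finset.sum_const, Finset.card_range,
    nsmul_eq_mul, hA]
  push_cast
  ring

/-- Markov's inequality in sequential form: the indicator of the event is the measurable function
dominated by U. -/
theorem prob_gap_gt_le_of_super (hp : IsNorm p) (hω : IsDGF p Z ω ω' α) (hZc : IsCompact Z)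
    (hZne : Z.Nonempty) (hZv : Convex ℝ Z) (hζ : ∀ i, Measurable (ζ i)) (hindep : iIndepFun ζ Pr)
    (hν : ∀ k, Pr.map (ζ k) = ν) (hΞ : Measurable fun q : Z × S => Ξ q.1 q.2)
    (hγ : 0 < γ) (hΦ : ContinuousOn Φ Z) {t : ℕ} (ht : 1 ≤ t) {T : ℝ}
    {U : ℕ → (ℕ → S) → ℝ} (hU : IsSequentialSuper ν (2 * t) U) (hU0 : ∀ s, 0 ≤ U (2 * t) s)
    (hU1 : ∀ s, T < Φ (output Z ω ω' (oracle Ξ s) (fun _ => γ) (center Z ω) t) →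
      1 ≤ U (2 * t) s) :
    Pr.real {x | T < Φ (smpOutput Z ω ω' Ξ ζ γ t x)} ≤ U 0 fun _ => default := by
  have hXm := (measurable_gap (S := S) (Ξ := Ξ) hp hω hZc hZne hZv hΞ hγ hΦ ht).1
  set B : Set (ℕ → S) :=
    {s | T < Φ (output Z ω ω' (oracle Ξ s) (fun _ => γ) (center Z ω) t)} with hBdef
  have hBm : MeasurableSet B := measurableSet_lt measurable_const hXm
  have h := hU.integral_le hζ hindep hν (X := B.indicator 1)
    (measurable_one.indicator hBm) (C := 1)
    (fun s => by by_cases hs : s ∈ B <;> simp [hs])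
    (fun s => by
      by_cases hs : s ∈ B
      · rw [Set.indicator_of_mem hs]
        exact hU1 s hs
      · rw [Set.indicator_of_notMem hs]
        exact hU0 s)
  have e0 : ∀ x, B.indicator (1 : (ℕ → S) → ℝ) (trunc (2 * t) fun i => ζ i x)
      = {x | T < Φ (smpOutput Z ω ω' Ξ ζ γ t x)}.indicator 1 x := fun x => by
    simp only [Set.indicator, hBdef, Set.mem_ofPred_eq, output_trunc, Pi.one_apply]
    rfl
  have hBm' : MeasurableSet {x | T < Φ (smpOutput Z ω ω' Ξ ζ γ t x)} :=
    measurableSet_lt measurable_const (hXm.comp (measurable_pi_iff.2 hζ))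
  simp only [e0] at h
  rwa [integral_indicator_one hBm'] at h

/-- The sum of the two exponential potentials carries the union bound: on the bad event either the
squared errors exceed (2 + Λ)tM² or the linear term reaches β. -/
theorem prob_gap_gt_le_of_pos (hp : IsNorm p) (hω : IsDGF p Z ω ω' α) (hZc : IsCompact Z)
    (hZne : Z.Nonempty) (hZv : Convex ℝ Z) (hL : 0 ≤ L) (hM : 0 < M)
    (hF : ∀ z ∈ Z, ∀ z' ∈ Z, dualNorm p (F z - F z') ≤ L * p (z - z') + M)
    (hζ : ∀ i, Measurable (ζ i)) (hindep : iIndepFun ζ Pr) (hν : ∀ k, Pr.map (ζ k) = ν)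
    (hΞ : Measurable fun q : Z × S => Ξ q.1 q.2) (hμ : 0 ≤ μ)
    (hnoise : IsOracleNoise ν p Z F Ξ μ M)
    (hexp : ∀ z ∈ Z, Integrable (fun a => Real.exp (dualNorm p (Ξ z a - F z) ^ 2 / M ^ 2)) ν ∧
      ∫ a, Real.exp (dualNorm p (Ξ z a - F z) ^ 2 / M ^ 2) ∂ν ≤ Real.exp 1)
    (hγ : 0 < γ) (hγL : √3 * L * γ ≤ α) (hΦ : IsGapBounded Z F Φ) {t : ℕ} (ht : 1 ≤ t)
    (hΩ : 0 < radius Z ω ω' α) {Λ : ℝ} (hΛ : 0 < Λ) {T : ℝ}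
    (hT : α * radius Z ω ω' α ^ 2 + (17 / 2 + 7 / 2 * Λ) * (t * (γ ^ 2 * M ^ 2 / α))
        + 2 * γ * μ * radius Z ω ω' α * t + γ * (4 / √3 * Λ * (radius Z ω ω' α * M * √t))
      ≤ γ * t * T) :
    Pr.real {x | T < Φ (smpOutput Z ω ω' Ξ ζ γ t x)}
      ≤ Real.exp (-Λ ^ 2 / 3) + Real.exp (-Λ * t) := by
  have hα := hω.modulus_pos
  have ht' : (0 : ℝ) < t := by exact_mod_cast ht
  have hprob : IsProbabilityMeasure ν :=
    hν 0 ▸ Measure.isProbabilityMeasure_map (hζ 0).aemeasurable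
  set Ω := radius Z ω ω' α with hΩdef
  set R : ℕ → ℝ := fun k => if k % 2 = 0 then 0 else 2 * Ω with hR
  have h3pos : 0 < √(3 : ℝ) := Real.sqrt_pos.2 (by norm_num)
  have h3sq : √(3 : ℝ) ^ 2 = 3 := Real.sq_sqrt (by norm_num)
  have hTpos : 0 < √(t : ℝ) := Real.sqrt_pos.2 ht'
  have hTsq : √(t : ℝ) ^ 2 = t := Real.sq_sqrt ht'.le
  -- The minimizer in θ of −θ(4/√3)ΛΩM√t + 4θ²Ω²M²t; the minimum is −2Λ²/3 + Λ²/3 = −Λ²/3.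
  set θ : ℝ := Λ / (√3 * (2 * Ω * M * √t)) with hθdef
  have hθ : 0 ≤ θ := by positivity
  set β : ℝ := 2 * μ * Ω * t + 4 / √3 * Λ * (Ω * M * √t) with hβ
  set e : ℕ → (ℕ → S) → S → E := callError Z ω ω' F Ξ γ with he
  set v : ℕ → (ℕ → S) → E := callTest Z ω ω' F Ξ γ with hv
  have hq : ∀ k (s : ℕ → S), query Z ω ω' (oracle Ξ s) (fun _ => γ) (center Z ω) k ∈ Z :=
    fun k s => query_mem hω hZc (center_mem hω hZc hZne) k
  have hsuper1 := isSequentialSuper_prod (ν := ν) (K := 2 * t)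
    (D := fun k s a => Real.exp (dualNorm p (e k s a) ^ 2 / M ^ 2)) (c := fun _ => Real.exp 1)
    (fun k s s' h => by rw [he, callError_congr h]) (fun _ _ _ => (Real.exp_pos _).le)
    (fun _ => (Real.exp_pos _).le) (fun k _ s => hexp _ (hq k s))
    (Real.exp_pos (-(2 * t) - Λ * t)).le
  have hsuper2 := isSequentialSuper_prod (ν := ν) (K := 2 * t)
    (D := fun k s a => Real.exp (-(θ * inner ℝ (e k s a) (v k s))))
    (c := fun k => Real.exp (θ * μ * R k + θ ^ 2 * R k ^ 2 * M ^ 2))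
    (fun k s s' h => by rw [he, hv, callError_congr h, callTest_congr h])
    (fun _ _ _ => (Real.exp_pos _).le) (fun _ => (Real.exp_pos _).le)
    (fun k _ s => integral_exp_neg_inner_le hp (hnoise.measurable _ (hq k s)) hμ hM
      (hnoise.integrable _ (hq k s)) (hnoise.bias _ (hq k s)) (hexp _ (hq k s)).1
      (hexp _ (hq k s)).2 (callTest_le hω hZc hZne k s) hθ)
    (Real.exp_pos (-(θ * β))).le
  have h := prob_gap_gt_le_of_super (Ξ := Ξ) (T := T) hp hω hZc hZne hZv hζ hindep hν hΞ hγ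
    hΦ.continuousOn ht (hsuper1.add hsuper2)
    (fun s => by
      rw [Finset.Ico_self, Finset.prod_empty, Finset.prod_empty, mul_one, mul_one,
        ← Real.exp_sum, ← Real.exp_sum]
      positivity)
    (fun s hs => by
      rw [Finset.Ico_self, Finset.prod_empty, Finset.prod_empty, mul_one, mul_one,
        ← Real.exp_sum, ← Real.exp_sum, ← Real.exp_add, ← Real.exp_add]
      set P : ℝ := ∑ k ∈ Finset.range (2 * t), dualNorm p (e k s (s k)) ^ 2 with hP
      set Q : ℝ := ∑ k ∈ Finset.range (2 * t), -inner ℝ (e k s (s k)) (v k s) with hQ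
      have e1 : ∑ k ∈ Finset.range (2 * t), dualNorm p (e k s (s k)) ^ 2 / M ^ 2
          = P / M ^ 2 := (Finset.sum_div _ _ _).symm
      have e2 : ∑ k ∈ Finset.range (2 * t), -(θ * inner ℝ (e k s (s k)) (v k s)) = θ * Q := by
        rw [hQ, Finset.mul_sum]
        exact Finset.sum_congr rfl fun _ _ => by ring
      have h1 := gap_output_le (Ξ := Ξ) hp hω hZc hZne hL hF hγ hγL hΦ ht s
      have e3 : ∑ k ∈ Finset.range (2 * t), (7 / 2 * γ ^ 2 / α * dualNorm p (e k s (s k)) ^ 2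
          - γ * inner ℝ (e k s (s k)) (v k s)) = 7 / 2 * γ ^ 2 / α * P + γ * Q := by
        rw [hP, hQ, Finset.mul_sum, Finset.mul_sum, ← Finset.sum_add_distrib]
        exact Finset.sum_congr rfl fun _ _ => by ring
      rw [e3] at h1
      rw [e1, e2]
      have h2 : γ * t * T
          < γ * t * Φ (output Z ω ω' (oracle Ξ s) (fun _ => γ) (center Z ω) t) :=
        mul_lt_mul_of_pos_left hs (by positivity)
      have h4 : 0 < 7 / 2 * γ ^ 2 / α * (P - (2 * t + Λ * t) * M ^ 2) + γ * (Q - β) := by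
        have e4 : 7 / 2 * γ ^ 2 / α * (P - (2 * t + Λ * t) * M ^ 2)
            = 7 / 2 * γ ^ 2 / α * P - (7 + 7 / 2 * Λ) * (t * (γ ^ 2 * M ^ 2 / α)) := by
          ring
        have e5 : γ * (Q - β) = γ * Q - 2 * γ * μ * Ω * t
            - γ * (4 / √3 * Λ * (Ω * M * √t)) := by
          rw [hβ]; ring
        rw [e4, e5]
        linarith
      rcases le_or_gt (P - (2 * t + Λ * t) * M ^ 2) 0 with h5 | h5
      · have h6 : 7 / 2 * γ ^ 2 / α * (P - (2 * t + Λ * t) * M ^ 2) ≤ 0 :=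
          mul_nonpos_of_nonneg_of_nonpos (by positivity) h5
        have h7 : 0 ≤ Q - β := ((mul_pos_iff_of_pos_left hγ).1 (by linarith)).le
        have h8 : 1 ≤ Real.exp (-(θ * β) + θ * Q) :=
          Real.one_le_exp (by have := mul_nonneg hθ h7; linarith)
        linarith [Real.exp_pos (-(2 * t) - Λ * t + P / M ^ 2)]
      · have h6 : 2 * t + Λ * t ≤ P / M ^ 2 := by
          rw [le_div_iff₀ (by positivity)]; linarith
        have h8 : 1 ≤ Real.exp (-(2 * t) - Λ * t + P / M ^ 2) := Real.one_le_exp (by linarith)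
        linarith [Real.exp_pos (-(θ * β) + θ * Q)])
  refine h.trans (le_of_eq ?_)
  rw [Finset.range_zero, Finset.prod_empty, Finset.prod_empty, mul_one, mul_one,
    ← Finset.range_eq_Ico, ← Real.exp_sum, ← Real.exp_sum, ← Real.exp_add, ← Real.exp_add,
    add_comm]
  have hR2 : ∀ k, R k ^ 2 = if k % 2 = 0 then 0 else (2 * Ω) ^ 2 := fun k => by
    rw [hR]; simp only; split_ifs <;> simp
  congr 2
  · rw [Finset.sum_add_distrib, ← Finset.mul_sum, ← Finset.sum_mul, ← Finset.mul_sum,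
      Finset.sum_congr rfl fun k _ => hR2 k, hR, sum_ite_even, sum_ite_even, hβ, hθdef]
    field_simp
    rw [h3sq]
    ring_nf
    rw [hTsq]
    ring
  · rw [Finset.sum_const, Finset.card_range, nsmul_eq_mul]
    push_cast
    ring

/-- Zero variance makes each error vanish almost surely at a fixed query; the potential counts the
calls with nonzero error, and without such calls the pathwise bound is deterministic. -/
theorem prob_gap_gt_eq_zero (hp : IsNorm p) (hω : IsDGF p Z ω ω' α) (hZc : IsCompact Z)
    (hZne : Z.Nonempty) (hZv : Convex ℝ Z) (hL : 0 ≤ L)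
    (hF : ∀ z ∈ Z, ∀ z' ∈ Z, dualNorm p (F z - F z') ≤ L * p (z - z') + 0)
    (hζ : ∀ i, Measurable (ζ i)) (hindep : iIndepFun ζ Pr) (hν : ∀ k, Pr.map (ζ k) = ν)
    (hΞ : Measurable fun q : Z × S => Ξ q.1 q.2)
    (hnoise : IsOracleNoise ν p Z F Ξ μ 0)
    (hγ : 0 < γ) (hγL : √3 * L * γ ≤ α) (hΦ : IsGapBounded Z F Φ) {t : ℕ} (ht : 1 ≤ t) {T : ℝ}
    (hT : α * radius Z ω ω' α ^ 2 ≤ γ * t * T) :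
    Pr.real {x | T < Φ (smpOutput Z ω ω' Ξ ζ γ t x)} ≤ 0 := by
  have ht' : (0 : ℝ) < t := by exact_mod_cast ht
  have hprob : IsProbabilityMeasure ν :=
    hν 0 ▸ Measure.isProbabilityMeasure_map (hζ 0).aemeasurable
  set e : ℕ → (ℕ → S) → S → E := callError Z ω ω' F Ξ γ with he
  classical
  have hsuper := isSequentialSuper_sum (ν := ν) (K := 2 * t)
    (D := fun k s a => if dualNorm p (e k s a) = 0 then 0 else 1) (c := fun _ => 0)
    (fun k s s' h => by rw [he, callError_congr h])
    (fun k _ s => by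
      have hq : query Z ω ω' (oracle Ξ s) (fun _ => γ) (center Z ω) k ∈ Z :=
        query_mem hω hZc (center_mem hω hZc hZne) k
      have h1 : ∫ a, dualNorm p (e k s a) ^ 2 ∂ν = 0 :=
        le_antisymm ((hnoise.variance _ hq).trans (by simp))
          (integral_nonneg fun a => sq_nonneg _)
      have h2 := (integral_eq_zero_iff_of_nonneg (fun a => sq_nonneg _)
        (hnoise.integrable _ hq)).1 h1
      have h3 : (fun a => if dualNorm p (e k s a) = 0 then (0 : ℝ) else 1) =ᵐ[ν] fun _ => 0 := by
        filter_upwards [h2] with a ha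
        exact if_pos (pow_eq_zero_iff two_ne_zero |>.1 ha)
      exact ⟨(integrable_zero _ _ _).congr h3.symm, by rw [integral_congr_ae h3]; simp⟩)
    0
  have hnn : ∀ s : ℕ → S, ∀ k ∈ Finset.range (2 * t),
      (0 : ℝ) ≤ if dualNorm p (e k s (s k)) = 0 then 0 else 1 := fun s k _ => by
    split_ifs <;> norm_num
  have h := prob_gap_gt_le_of_super (Ξ := Ξ) (T := T) hp hω hZc hZne hZv hζ hindep hν hΞ hγ
    hΦ.continuousOn ht hsuper
    (fun s => by
      rw [Finset.Ico_self, Finset.sum_empty, add_zero, zero_add]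
      exact Finset.sum_nonneg (hnn s))
    (fun s hs => by
      rw [Finset.Ico_self, Finset.sum_empty, add_zero, zero_add]
      by_cases hall : ∀ k ∈ Finset.range (2 * t), dualNorm p (e k s (s k)) = 0
      · have h1 := gap_output_le (Ξ := Ξ) hp hω hZc hZne hL hF hγ hγL hΦ ht s
        rw [Finset.sum_eq_zero fun k hk => by
          have := hall k hk
          rw [← he, this, eq_zero_of_dualNorm_eq_zero hp this]
          simp] at h1
        have h2 : γ * t * T
            < γ * t * Φ (output Z ω ω' (oracle Ξ s) (fun _ => γ) (center Z ω) t) :=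
          mul_lt_mul_of_pos_left hs (by positivity)
        rw [zero_pow two_ne_zero, mul_zero, zero_div, mul_zero, mul_zero] at h1
        linarith
      · push Not at hall
        obtain ⟨k, hk, hne⟩ := hall
        refine le_trans (le_of_eq ?_) (Finset.single_le_sum (hnn s) hk)
        rw [if_neg hne])
  simpa using h

/-- Both bounds, for any quantity controlled by the averaged gap. -/
theorem gap_bounds (hp : IsNorm p) (hω : IsDGF p Z ω ω' α) (hZc : IsCompact Z)
    (hZne : Z.Nonempty) (hZv : Convex ℝ Z) (hL : 0 ≤ L) (hM : 0 ≤ M)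
    (hF : ∀ z ∈ Z, ∀ z' ∈ Z, dualNorm p (F z - F z') ≤ L * p (z - z') + M)
    (hζ : ∀ i, Measurable (ζ i)) (hindep : iIndepFun ζ Pr)
    (hident : ∀ i, IdentDistrib (ζ i) (ζ 0) Pr Pr)
    (hΞ : Measurable fun q : Z × S => Ξ q.1 q.2) (hμ : 0 ≤ μ)
    (hI : AssumptionI Pr p Z F Ξ ζ μ M) {t : ℕ} (ht : 1 ≤ t) (hγ : 0 < γ)
    (hstep : ENNReal.ofReal γ = optimalStep α L M (radius Z ω ω' α) t)
    (hΦ : IsGapBounded Z F Φ) :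
    (Integrable (fun x => Φ (smpOutput Z ω ω' Ξ ζ γ t x)) Pr ∧
      ∫ x, Φ (smpOutput Z ω ω' Ξ ζ γ t x) ∂Pr ≤ K₀ L M μ (radius Z ω ω' α) t) ∧
    (AssumptionII Pr p Z F Ξ ζ M → ∀ Λ : ℝ, 0 < Λ →
      Pr.real {x | K₀ L M μ (radius Z ω ω' α) t + Λ * K₁ M (radius Z ω ω' α) t <
          Φ (smpOutput Z ω ω' Ξ ζ γ t x)} ≤
        Real.exp (-Λ ^ 2 / 3) + Real.exp (-Λ * t)) := by
  have hα := hω.modulus_pos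
  have ht' : (0 : ℝ) < t := by exact_mod_cast ht
  have hν : ∀ k, Pr.map (ζ k) = Pr.map (ζ 0) := fun k => (hident k).map_eq
  have hnoise := hI.isOracleNoise hp (hζ 0) hΞ
  have hΩ0 : 0 ≤ radius Z ω ω' α := Real.sqrt_nonneg _
  obtain ⟨hγL, hs1, hs2, hs3⟩ := optimalStep_bounds hα hL hM hΩ0 ht hγ hstep
  have hpos : 0 ≤ γ * (radius Z ω ω' α * M * √t) := by positivity
  refine ⟨?_, fun hII Λ hΛ => ?_⟩
  · obtain ⟨h1, h2⟩ := integral_gap_le hp hω hZc hZne hZv hL hF hζ hindep hν hΞ hμ hnoise hγ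
      hγL hΦ ht
    refine ⟨h1, le_of_mul_le_mul_left ?_ (mul_pos hγ ht')⟩
    -- The coefficient of γΩM√t is 13/4 + (17/2)·0.31 < 7.
    rw [mul_K₀ ht]
    linarith
  · rcases hM.eq_or_lt with h0 | h0
    · subst h0
      refine (prob_gap_gt_eq_zero hp hω hZc hZne hZv hL hF hζ hindep hν hΞ hnoise hγ hγL hΦ ht
        ?_).trans (by positivity)
      have : 0 ≤ 2 * γ * μ * radius Z ω ω' α * t := by positivity
      rw [mul_add, mul_K₀ ht, mul_left_comm (γ * t), mul_K₁ ht]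
      linarith
    · refine prob_gap_gt_le_of_pos hp hω hZc hZne hZv hL h0 hF hζ hindep hν hΞ hμ hnoise
        (fun z hz => hII.map hp (hζ 0) hnoise.measurable hz) hγ hγL hΦ ht (hs3 h0) hΛ ?_
      -- The deviation budget is (7/2)·0.31 + 2.31 = 3.395 ≤ 7/2.
      have h3 : 4 / √3 ≤ (2.31 : ℝ) := by
        have h3pos : 0 < √(3 : ℝ) := Real.sqrt_pos.2 (by norm_num)
        rw [div_le_iff₀ h3pos]
        have : (4 / 2.31 : ℝ) ≤ √3 := Real.le_sqrt_of_sq_le (by norm_num)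
        rw [div_le_iff₀ (by norm_num)] at this
        linarith
      rw [mul_add, mul_K₀ ht, mul_left_comm (γ * t), mul_K₁ ht]
      have h4 := mul_le_mul_of_nonneg_right h3 (mul_nonneg hΛ.le hpos)
      have h5 := mul_le_mul_of_nonneg_left hs2 hΛ.le
      have h6 := mul_nonneg hΛ.le hpos
      linarith

end Bounds

end SMP

end

theorem mainTheorem2
    {E : Type*} [NormedAddCommGroup E] [InnerProductSpace ℝ E] [FiniteDimensional ℝ E]
    [MeasurableSpace E] [BorelSpace E]
    -- the norm, the domain and the distance-generating function
    (p : Seminorm ℝ E) (hp : SMP.IsNorm p)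
    (Z : Set E) (hZne : Z.Nonempty) (hZcomp : IsCompact Z) (hZconv : Convex ℝ Z)
    (ω : E → ℝ) (ω' : E → E) (α : ℝ) (hω : SMP.IsDGF p Z ω ω' α)
    -- the operator
    (F : E → E) (hFmono : SMP.IsMonotoneOp Z F)
    (L M : ℝ) (hL : 0 ≤ L) (hM : 0 ≤ M)
    (hF : ∀ z ∈ Z, ∀ z' ∈ Z, SMP.dualNorm p (F z - F z') ≤ L * p (z - z') + M)
    -- the stochastic oracle
    {Ω₀ : Type*} [MeasurableSpace Ω₀] (Pr : MeasureTheory.Measure Ω₀)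
    [MeasureTheory.IsProbabilityMeasure Pr]
    (N : ℕ) (ζ : ℕ → Ω₀ → EuclideanSpace ℝ (Fin N)) (hζ : ∀ i, Measurable (ζ i))
    (hindep : ProbabilityTheory.iIndepFun ζ Pr)
    (hident : ∀ i, ProbabilityTheory.IdentDistrib (ζ i) (ζ 0) Pr Pr)
    (Ξ : E → EuclideanSpace ℝ (Fin N) → E)
    (hΞ : Measurable (fun q : Z × EuclideanSpace ℝ (Fin N) => Ξ q.1 q.2))
    (μ : ℝ) (hμ : 0 ≤ μ) (hI : SMP.AssumptionI Pr p Z F Ξ ζ μ M)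
    -- the number of steps and the stepsize
    (t : ℕ) (ht : 1 ≤ t) (Ω : ℝ) (hΩ : Ω = SMP.radius Z ω ω' α)
    (γ : ℝ) (hγ : 0 < γ) (hstep : ENNReal.ofReal γ = SMP.optimalStep α L M Ω t) :
    (MeasureTheory.Integrable
        (fun x => SMP.errVI Z F (SMP.smpOutput Z ω ω' Ξ ζ γ t x)) Pr ∧
      ∫ x, SMP.errVI Z F (SMP.smpOutput Z ω ω' Ξ ζ γ t x) ∂Pr ≤ SMP.K₀ L M μ Ω t) ∧
    (SMP.AssumptionII Pr p Z F Ξ ζ M → ∀ Λ : ℝ, 0 < Λ →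
      Pr.real {x | SMP.K₀ L M μ Ω t + Λ * SMP.K₁ M Ω t <
          SMP.errVI Z F (SMP.smpOutput Z ω ω' Ξ ζ γ t x)} ≤
        Real.exp (-Λ ^ 2 / 3) + Real.exp (-Λ * t)) ∧
    -- the case of a Nash v.i.
    (∀ (m : ℕ) (V : Fin m → Type*) [∀ i, NormedAddCommGroup (V i)]
      [∀ i, InnerProductSpace ℝ (V i)] (e : E ≃ₗᵢ[ℝ] PiLp 2 V)
      (Zs : ∀ i, Set (V i)) (φ : Fin m → (∀ j, V j) → ℝ), SMP.IsNashVI e Z F Zs φ →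
      (MeasureTheory.Integrable
          (fun x => SMP.errN Zs φ (fun j => e (SMP.smpOutput Z ω ω' Ξ ζ γ t x) j)) Pr ∧
        ∫ x, SMP.errN Zs φ (fun j => e (SMP.smpOutput Z ω ω' Ξ ζ γ t x) j) ∂Pr ≤
          SMP.K₀ L M μ Ω t) ∧
      (SMP.AssumptionII Pr p Z F Ξ ζ M → ∀ Λ : ℝ, 0 < Λ →
        Pr.real {x | SMP.K₀ L M μ Ω t + Λ * SMP.K₁ M Ω t <
            SMP.errN Zs φ (fun j => e (SMP.smpOutput Z ω ω' Ξ ζ γ t x) j)} ≤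
          Real.exp (-Λ ^ 2 / 3) + Real.exp (-Λ * t))) := by
  subst hΩ
  refine ⟨(SMP.gap_bounds hp hω hZcomp hZne hZconv hL hM hF hζ hindep hident hΞ hμ hI ht hγ hstep
    (SMP.isGapBounded_errVI hp hZne hZcomp hFmono hL hF)).1,
    (SMP.gap_bounds hp hω hZcomp hZne hZconv hL hM hF hζ hindep hident hΞ hμ hI ht hγ hstep
    (SMP.isGapBounded_errVI hp hZne hZcomp hFmono hL hF)).2, ?_⟩
  intro m V _ _ e Zs φ hN
  exact SMP.gap_bounds hp hω hZcomp hZne hZconv hL hM hF hζ hindep hident hΞ hμ hI ht hγ hstep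
    (SMP.isGapBounded_errN hZconv hN)
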